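/- Let $\Gamma$ be a finite simplicial graph with vertex set $V$, and let $A_\Gamma$ be its right-angled Artin group, with generating set $V$ and relations $[v,w]=1$ for adjacent $v,w$. Write $V^{\pm}=\{v,v^{-1}\mid v\in V\}$, $\mathrm{lk}(v)$ for the set of neighbours of $v$, $\mathrm{st}(v)=\mathrm{lk}(v)\cup\{v\}$, and $v\le w$ if $\mathrm{lk}(v)\subseteq \mathrm{st}(w)$; adjacency and $\le$ are applied to elements of $V^\pm$ through the underlying vertices. Let $\mathrm{Out}_\ell(A_\Gamma)\le \mathrm{Out}(A_\Gamma)$ be the subgroup generated by the classes of graph automorphisms, inversions, partial conjugations and non-adjacent transvections ($v\mapsto vw$ for $v\le w$, $v\neq w$ not adjacent). *Marked Salvettis.* Let $\mathbb S$ be the Salvetti complex of $A_\Gamma$, and identify homotopy classes of homotopy equivalences $\mathbb S\to\mathbb S$ with elements of $\mathrm{Out}(A_\Gamma)$. A marked Salvetti is the class $\sigma=(\mathbb S,\varphi)$ of an element $\varphi\in\mathrm{Out}_\ell(A_\Gamma)$, where $(\mathbb S,\varphi)=(\mathbb S,\varphi')$ if $\varphi=\varphi'\circ h$ for some $h$ induced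 by an isomorphism of cube complexes $\mathbb S\to\mathbb S$, i.e. by a permutation of $V^{\pm}$ that commutes with inversion and preserves adjacency and non-adjacency. *Norm.* For a conjugacy class $g$ of $A_\Gamma$ let $\ell_\sigma(g)$ be the minimal length of a word in the letters $V^\pm$ that represents an element of the conjugacy class $\varphi^{-1}(g)$; this depends only on $\sigma$ and $g$. Let $\mathcal G_0$ be the finite set of conjugacy classes that can be represented by words of length at most $2$, and fix a list $(g_1,g_2,\dots)$ of all conjugacy classes of $A_\Gamma$ (repetitions allowed). Put $$\|\sigma\|=\bigl(\|\sigma\|_0,\ \ell_\sigma(g_1),\ \ell_\sigma(g_2),\dots\bigr),\qquad \|\sigma\|_0=\sum_{g\in\mathcal G_0}\ell_\sigma(g),$$ and order these sequences of integers lexicographically. *$\Gamma$-Whitehead moves.* A pair $(P,m)$ with $P\subseteq V^\pm$, $|P|\ge 2$, $m\in P$, $m^{-1}\notin P$ is a $\Gamma$-Whitehead pair if (1) no element of $P$ is adjacent to $m$; (2) if $x\in P$ and $x^{-1}\notin P$, then $x\le m$; (3) if $v,v^{-1}\in P$, then $w,w^{-1}\in P$ for all $w$ in the same component of $\Gamma\setminus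 \mathrm{st}(m)$ as $v$. Its Whitehead automorphism $\alpha$ of $A_\Gamma$ sends $m$ to $m^{-1}$ and, for $x\in V^\pm\setminus\{m,m^{-1}\}$, sends $x$ to $xm^{-1}$ if $x\in P$, $x^{-1}\notin P$; to $mx$ if $x^{-1}\in P$, $x\notin P$; to $mxm^{-1}$ if $x,x^{-1}\in P$; and to $x$ otherwise. Its class lies in $\mathrm{Out}_\ell(A_\Gamma)$. The $\Gamma$-Whitehead move from $\sigma=(\mathbb S,\varphi)$ given by $(P,m)$ leads to the marked Salvetti $\sigma^{P}_m=(\mathbb S,\varphi\circ\alpha)$; it is strongly reductive if $\|\sigma^{P}_m\|_0<\|\sigma\|_0$. **Statement.** Let $\sigma=(\mathbb S,\varphi)$ be a marked Salvetti whose norm is not minimal, i.e. $\|\tau\|<\|\sigma\|$ for some marked Salvetti $\tau$. Then there is a strongly reductive $\Gamma$-Whitehead move from $\sigma$: there is a $\Gamma$-Whitehead pair $(P,m)$ with $\|\sigma^{P}_m\|_0<\|\sigma\|_0$. -/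

import Mathlib

namespace RaagOuter

/-! ### Right-angled Artin groups -/

/-- The defining relators of the right-angled Artin group of `Γ`: the commutators of the pairs of
adjacent vertices. -/
def relators {V : Type*} (Γ : SimpleGraph V) : Set (FreeGroup V) :=
  {r | ∃ v w : V, Γ.Adj v w ∧ 
    r = FreeGroup.of v * FreeGroup.of w * (FreeGroup.of v)⁻¹ * (FreeGroup.of w)⁻¹}

/-- The right-angled Artin group `A_Γ`. -/
abbrev RAAG {V : Type*} (Γ : SimpleGraph V) : Type _ := PresentedGroup (relators Γ)

/-- The generator of `A_Γ` belonging to a vertex. -/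
def gen {V : Type*} (Γ : SimpleGraph V) (v : V) : RAAG Γ := PresentedGroup.of v

/-- The symmetric set `V^±`: `(v, true)` stands for `v` and `(v, false)` for `v⁻¹`. -/
abbrev Sgn (V : Type*) : Type _ := V × Bool

/-- The formal inverse on `V^±`. -/
def Sgn.inv {V : Type*} (x : Sgn V) : Sgn V := (x.1, !x.2)

/-- The element of `A_Γ` given by an element of `V^±`. -/
def letter {V : Type*} (Γ : SimpleGraph V) (x : Sgn V) : RAAG Γ :=
  if x.2 then gen Γ x.1 else (gen Γ x.1)⁻¹

/-- The element of `A_Γ` represented by a word in the letters `V^±`. -/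
def wordVal {V : Type*} (Γ : SimpleGraph V) (w : List (Sgn V)) : RAAG Γ :=
  (w.map (letter Γ)).prod

/-- The link of a vertex. -/
def lk {V : Type*} (Γ : SimpleGraph V) (v : V) : Set V := {u | Γ.Adj v u}

/-- The star of a vertex. -/
def st {V : Type*} (Γ : SimpleGraph V) (v : V) : Set V := insert v (lk Γ v)

/-- The relation `v ≤ w` on vertices: `lk(v) ⊆ st(w)`. -/
def vle {V : Type*} (Γ : SimpleGraph V) (v w : V) : Prop := lk Γ v ⊆ st Γ w

/-- `u` and `w` are vertices of the same connected component of `Γ ∖ st(m)`. -/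
def SameComp {V : Type*} (Γ : SimpleGraph V) (m u w : V) : Prop :=
  ∃ (hu : u ∈ (st Γ m)ᶜ) (hw : w ∈ (st Γ m)ᶜ), (Γ.induce (st Γ m)ᶜ).Reachable ⟨u, hu⟩ ⟨w, hw⟩

/-! ### Outer automorphisms and the subgroup of long-range ones -/

instance innNormal (A : Type*) [Group A] : (MulAut.conj : A →* MulAut A).range.Normal where
  conj_mem := by
    rintro _ ⟨a, rfl⟩ f
    refine ⟨f a, ?_⟩
    ext x
    simp

/-- The outer automorphism group of a group. -/
abbrev Out (A : Type*) [Group A] : Type _ := MulAut A ⧸ (MulAut.conj : A →* MulAut A).range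

/-- The outer automorphism class of an automorphism. -/
def outMk {A : Type*} [Group A] : MulAut A →* Out A := QuotientGroup.mk' _

/-- The action of `Aut(A)` on the conjugacy classes of `A`. -/
def autOnClasses (A : Type*) [Group A] : MulAut A →* Equiv.Perm (ConjClasses A) where
  toFun f :=
    { toFun := ConjClasses.map (f : A →* A)
      invFun := ConjClasses.map ((f⁻¹ : MulAut A) : A →* A)
      left_inv := by
        intro c
        obtain ⟨a, rfl⟩ := ConjClasses.mk_surjective c
        change ConjClasses.mk ((f⁻¹ : MulAut A) (f a)) = _
        simp
      right_inv := by
        intro c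
        obtain ⟨a, rfl⟩ := ConjClasses.mk_surjective c
        change ConjClasses.mk (f ((f⁻¹ : MulAut A) a)) = _
        simp }
  map_one' := by
    ext c
    obtain ⟨a, rfl⟩ := ConjClasses.mk_surjective c
    rfl
  map_mul' f g := by
    ext c
    obtain ⟨a, rfl⟩ := ConjClasses.mk_surjective c
    rfl

/-- The action of `Out(A)` on the conjugacy classes of `A`: the class of `f` sends the conjugacy
class of `a` to that of `f a`. -/
def outOnClasses (A : Type*) [Group A] : Out A →* Equiv.Perm (ConjClasses A) :=
  QuotientGroup.lift _ (autOnClasses A) (by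
    rintro _ ⟨b, rfl⟩
    ext c
    obtain ⟨a, rfl⟩ := ConjClasses.mk_surjective c
    change ConjClasses.mk (b * a * b⁻¹) = ConjClasses.mk a
    exact (ConjClasses.mk_eq_mk_iff_isConj.2 (isConj_iff.2 ⟨b, rfl⟩)).symm)

/-- Graph automorphisms: induced by an automorphism of `Γ`. -/
def IsGraphAut {V : Type*} (Γ : SimpleGraph V) (f : MulAut (RAAG Γ)) : Prop :=
  ∃ p : Γ ≃g Γ, ∀ v, f (gen Γ v) = gen Γ (p v)

/-- Inversions: `v ↦ v⁻¹` for one vertex `v`, all other generators fixed. -/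
def IsInversion {V : Type*} (Γ : SimpleGraph V) (f : MulAut (RAAG Γ)) : Prop :=
  ∃ v, f (gen Γ v) = (gen Γ v)⁻¹ ∧ ∀ u, u ≠ v → f (gen Γ u) = gen Γ u

/-- Non-adjacent transvections: `v ↦ v w` with `v ≤ w`, where `v ≠ w` are not adjacent, all other
generators fixed. -/
def IsNonadjTransvection {V : Type*} (Γ : SimpleGraph V) (f : MulAut (RAAG Γ)) : Prop :=
  ∃ v w, v ≠ w ∧ ¬ Γ.Adj v w ∧ vle Γ v w ∧
    f (gen Γ v) = gen Γ v * gen Γ w ∧ ∀ u, u ≠ v → f (gen Γ u) = gen Γ u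

/-- Partial conjugations: `x ↦ v x v⁻¹` for the vertices `x` of one component `C` of `Γ ∖ st(v)`,
all other generators fixed. -/
def IsPartialConj {V : Type*} (Γ : SimpleGraph V) (f : MulAut (RAAG Γ)) : Prop :=
  ∃ (v : V) (C : (Γ.induce (st Γ v)ᶜ).ConnectedComponent), ∀ x,
    (x ∈ Subtype.val '' C.supp → f (gen Γ x) = gen Γ v * gen Γ x * (gen Γ v)⁻¹) ∧
    (x ∉ Subtype.val '' C.supp → f (gen Γ x) = gen Γ x)

/-- The subgroup `Out_ℓ(A_Γ)` of `Out(A_Γ)` generated by graph automorphisms, inversions, partial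
conjugations and non-adjacent transvections. -/
def Outl {V : Type*} (Γ : SimpleGraph V) : Subgroup (Out (RAAG Γ)) :=
  Subgroup.closure (outMk '' {f |
    IsGraphAut Γ f ∨ IsInversion Γ f ∨ IsPartialConj Γ f ∨ IsNonadjTransvection Γ f})

/-! ### Marked Salvetti complexes

The Salvetti complex `𝕊` is a `K(A_Γ, 1)`, and homotopy classes of homotopy equivalences `𝕊 → 𝕊`
are identified with elements of `Out(A_Γ)`.  So a marked Salvetti complex is represented by a pair
`(𝕊, φ)` with `φ ∈ Out_ℓ(A_Γ)`, and `(𝕊, φ)` and `(𝕊, φ')` are equivalent if `φ' ∘ h = φ` for some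
isomorphism of cube complexes `h : 𝕊 → 𝕊`.  Such an isomorphism is given by a permutation of the
directed edges of `𝕊`, that is, of `V^±`, which respects the reversal of edges and the property of
spanning a square. -/

/-- `f` is the automorphism of `A_Γ` induced by a cube complex isomorphism of `𝕊`. -/
def IsSalvettiIso {V : Type*} (Γ : SimpleGraph V) (f : MulAut (RAAG Γ)) : Prop :=
  ∃ p : Equiv.Perm (Sgn V), (∀ x, p x.inv = (p x).inv) ∧
    (∀ x y, Γ.Adj (p x).1 (p y).1 ↔ Γ.Adj x.1 y.1) ∧ ∀ x, f (letter Γ x) = letter Γ (p x)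

theorem IsSalvettiIso.one {V : Type*} (Γ : SimpleGraph V) : IsSalvettiIso Γ 1 :=
  ⟨1, by simp⟩

theorem IsSalvettiIso.mul {V : Type*} {Γ : SimpleGraph V} {f g : MulAut (RAAG Γ)}
    (hf : IsSalvettiIso Γ f) (hg : IsSalvettiIso Γ g) : IsSalvettiIso Γ (f * g) := by
  obtain ⟨p, hp1, hp2, hp3⟩ := hf
  obtain ⟨q, hq1, hq2, hq3⟩ := hg
  refine ⟨p * q, fun x => ?_, fun x y => ?_, fun x => ?_⟩
  · simp [hp1, hq1]
  · simp [hp2, hq2]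
  · simp [hp3, hq3]

theorem IsSalvettiIso.symm {V : Type*} {Γ : SimpleGraph V} {f : MulAut (RAAG Γ)}
    (hf : IsSalvettiIso Γ f) : IsSalvettiIso Γ f⁻¹ := by
  obtain ⟨p, hp1, hp2, hp3⟩ := hf
  refine ⟨p⁻¹, fun x => ?_, fun x y => ?_, fun x => ?_⟩
  · apply p.injective
    simp [hp1]
  · rw [← hp2]
    simp
  · apply f.injective
    simp [hp3]

/-- Equivalence of the marked complexes `(𝕊, φ)` and `(𝕊, φ')`. -/
def markedSetoid {V : Type*} (Γ : SimpleGraph V) : Setoid (Outl Γ) where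
  r φ φ' := ∃ h, IsSalvettiIso Γ h ∧ (φ' : Out (RAAG Γ)) * outMk h = φ
  iseqv :=
    { refl := fun φ => ⟨1, IsSalvettiIso.one Γ, by simp⟩
      symm := by
        rintro φ φ' ⟨h, hh, e⟩
        exact ⟨h⁻¹, hh.symm, by rw [← e]; simp⟩
      trans := by
        rintro φ φ' φ'' ⟨h, hh, e⟩ ⟨k, hk, e'⟩
        exact ⟨k * h, hk.mul hh, by rw [← e, ← e', map_mul, mul_assoc]⟩ }

/-- The set of marked Salvetti complexes. -/
def MarkedSalvetti {V : Type*} (Γ : SimpleGraph V) : Type _ := Quotient (markedSetoid Γ)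

/-- The marked Salvetti complex `(𝕊, φ)`. -/
def marked {V : Type*} {Γ : SimpleGraph V} (φ : Outl Γ) : MarkedSalvetti Γ :=
  Quotient.mk (markedSetoid Γ) φ

/-! ### The norm -/

/-- The minimal length of a word representing an element of the given conjugacy class. -/
noncomputable def classLength {V : Type*} (Γ : SimpleGraph V) (c : ConjClasses (RAAG Γ)) : ℕ :=
  sInf {n | ∃ w : List (Sgn V), w.length = n ∧ ConjClasses.mk (wordVal Γ w) = c}

theorem letter_inv {V : Type*} (Γ : SimpleGraph V) (x : Sgn V) :
    letter Γ x.inv = (letter Γ x)⁻¹ := by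
  rcases x with ⟨v, _ | _⟩ <;> simp [letter, Sgn.inv]

/-- Every conjugacy class is represented by a word. -/
theorem exists_word {V : Type*} (Γ : SimpleGraph V) (c : ConjClasses (RAAG Γ)) :
    ∃ w : List (Sgn V), ConjClasses.mk (wordVal Γ w) = c := by
  obtain ⟨a, rfl⟩ := ConjClasses.mk_surjective c
  obtain ⟨u, rfl⟩ := PresentedGroup.mk_surjective _ a
  obtain ⟨L, rfl⟩ : ∃ L, FreeGroup.mk L = u := Quot.exists_rep u
  refine ⟨L, congrArg _ ?_⟩
  have key : ∀ L : List (Sgn V),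
      PresentedGroup.mk (relators Γ) (FreeGroup.mk L) = wordVal Γ L := by
    intro L
    induction L with
    | nil => exact map_one _
    | cons x L ih =>
      have h1 : (FreeGroup.mk (x :: L) : FreeGroup V) = FreeGroup.mk [x] * FreeGroup.mk L := by
        simp [FreeGroup.mul_mk]
      have h2 : PresentedGroup.mk (relators Γ) (FreeGroup.mk [x]) = letter Γ x := by
        rcases x with ⟨v, _ | _⟩
        · have : (FreeGroup.mk [(v, false)] : FreeGroup V) = (FreeGroup.of v)⁻¹ := by
            simp [FreeGroup.of, FreeGroup.inv_mk, FreeGroup.invRev]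
          rw [this, map_inv]
          rfl
        · rfl
      rw [h1, map_mul, ih, h2]
      simp [wordVal]
  exact (key L).symm

theorem classLength_autOnClasses_le {V : Type*} {Γ : SimpleGraph V} {f : MulAut (RAAG Γ)}
    (hf : IsSalvettiIso Γ f) (c : ConjClasses (RAAG Γ)) :
    classLength Γ (autOnClasses _ f c) ≤ classLength Γ c := by
  obtain ⟨p, -, -, hp⟩ := hf
  obtain ⟨w0, hw0⟩ := exists_word Γ c
  obtain ⟨w, hw, hc⟩ := Nat.sInf_mem
    (s := {n | ∃ w : List (Sgn V), w.length = n ∧ ConjClasses.mk (wordVal Γ w) = c})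
    ⟨_, w0, rfl, hw0⟩
  refine Nat.sInf_le ⟨w.map p, by rw [List.length_map, hw]; rfl, ?_⟩
  rw [← hc]
  change _ = ConjClasses.mk (f (wordVal Γ w))
  congr 1
  simp only [wordVal, map_list_prod, List.map_map]
  congr 2
  ext x
  simp [hp]

theorem classLength_autOnClasses {V : Type*} {Γ : SimpleGraph V} {f : MulAut (RAAG Γ)}
    (hf : IsSalvettiIso Γ f) (c : ConjClasses (RAAG Γ)) :
    classLength Γ (autOnClasses _ f c) = classLength Γ c := by
  refine le_antisymm (classLength_autOnClasses_le hf c) ?_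
  have h := classLength_autOnClasses_le hf.symm (autOnClasses _ f c)
  rwa [← Equiv.Perm.mul_apply, ← map_mul, inv_mul_cancel, map_one, Equiv.Perm.one_apply] at h

/-- `ℓ_σ(g)` for `σ = (𝕊, φ)`: the minimal length of a word representing an element of the
conjugacy class `φ⁻¹(g)`. -/
noncomputable def len {V : Type*} {Γ : SimpleGraph V} (σ : MarkedSalvetti Γ)
    (g : ConjClasses (RAAG Γ)) : ℕ :=
  Quotient.lift (s := markedSetoid Γ)
    (fun φ : Outl Γ => classLength Γ (outOnClasses _ (φ : Out (RAAG Γ))⁻¹ g))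
    (by
      rintro φ φ' ⟨h, hh, e⟩
      rw [← e, mul_inv_rev, map_mul, Equiv.Perm.mul_apply, ← map_inv (outMk (A := RAAG Γ))]
      exact classLength_autOnClasses hh.symm _) σ

/-- The set `𝒢₀` of conjugacy classes which can be represented by words of length at most `2`. -/
def shortClasses {V : Type*} (Γ : SimpleGraph V) : Set (ConjClasses (RAAG Γ)) :=
  {c | ∃ w : List (Sgn V), w.length ≤ 2 ∧ ConjClasses.mk (wordVal Γ w) = c}

theorem shortClasses_finite {V : Type*} [Finite V] (Γ : SimpleGraph V) :
    (shortClasses Γ).Finite :=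
  (List.finite_length_le (Sgn V) 2).image fun w => ConjClasses.mk (wordVal Γ w)

/-- The first coordinate `‖σ‖₀` of the norm. -/
noncomputable def norm0 {V : Type*} [Finite V] {Γ : SimpleGraph V} (σ : MarkedSalvetti Γ) : ℤ :=
  ∑ g ∈ (shortClasses_finite Γ).toFinset, (len σ g : ℤ)

/-- The norm `‖σ‖ = (‖σ‖₀, ℓ_σ(g₀), ℓ_σ(g₁), …)` with respect to a list `g` of conjugacy classes.
It lies in `ℤ × ℤ^ℕ` with the lexicographic order. -/
noncomputable def salvettiNorm {V : Type*} [Finite V] {Γ : SimpleGraph V}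
    (g : ℕ → ConjClasses (RAAG Γ)) (σ : MarkedSalvetti Γ) : ℤ ×ₗ Lex (ℕ → ℤ) :=
  toLex (norm0 σ, toLex fun i => (len σ (g i) : ℤ))

/-! ### `Γ`-Whitehead moves -/

/-- `(P, m)` is a `Γ`-Whitehead pair. -/
structure IsWhiteheadPair {V : Type*} (Γ : SimpleGraph V) (P : Set (Sgn V)) (m : Sgn V) :
    Prop where
  nontrivial : P.Nontrivial
  mem : m ∈ P
  inv_notMem : m.inv ∉ P
  not_adj : ∀ x ∈ P, ¬ Γ.Adj x.1 m.1
  single_le : ∀ x ∈ P, x.inv ∉ P → vle Γ x.1 m.1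
  double_comp : ∀ v w : V, (v, true) ∈ P → (v, false) ∈ P → SameComp Γ m.1 v w →
    (w, true) ∈ P ∧ (w, false) ∈ P

/-- `f` is the Whitehead automorphism of `A_Γ` given by the pair `(P, m)`. -/
structure IsWhiteheadAut {V : Type*} (Γ : SimpleGraph V) (P : Set (Sgn V)) (m : Sgn V)
    (f : MulAut (RAAG Γ)) : Prop where
  map_max : f (letter Γ m) = (letter Γ m)⁻¹
  map_single : ∀ x : Sgn V, x.1 ≠ m.1 → x ∈ P → x.inv ∉ P →
    f (letter Γ x) = letter Γ x * (letter Γ m)⁻¹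
  map_single' : ∀ x : Sgn V, x.1 ≠ m.1 → x.inv ∈ P → x ∉ P →
    f (letter Γ x) = letter Γ m * letter Γ x
  map_double : ∀ x : Sgn V, x.1 ≠ m.1 → x ∈ P → x.inv ∈ P →
    f (letter Γ x) = letter Γ m * letter Γ x * (letter Γ m)⁻¹
  map_other : ∀ x : Sgn V, x.1 ≠ m.1 → x ∉ P → x.inv ∉ P → f (letter Γ x) = letter Γ x

/-- `τ` is the result `(𝕊, φ ∘ α)` of the `Γ`-Whitehead move from `(𝕊, φ)` given by the pair
`(P, m)`, where `α ∈ Out_ℓ(A_Γ)` is the class of the Whitehead automorphism `(P, m)`. -/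
def IsWhiteheadMove {V : Type*} {Γ : SimpleGraph V} (φ : Outl Γ) (P : Set (Sgn V)) (m : Sgn V)
    (τ : MarkedSalvetti Γ) : Prop :=
  IsWhiteheadPair Γ P m ∧ ∃ (f : MulAut (RAAG Γ)) (hf : outMk f ∈ Outl Γ),
    IsWhiteheadAut Γ P m f ∧ τ = marked (φ * ⟨outMk f, hf⟩)

end RaagOuter

namespace RaagOuter

/-! ### Words -/

section Words

variable {V : Type*} {Γ : SimpleGraph V}

/-! The argument is peak reduction. Call ‖σ‖₀ the height of σ. It suffices that every marked complex
other than `marked 1` has a neighbour, under Whitehead moves, of strictly smaller height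
(`exists_lower`). By descent `marked 1` is then the unique minimum of the height, hence also
minimizes the norm, so a complex of non-minimal norm differs from it.

Counting: in a right-angled Artin group a cyclically reduced word minimizes the number of letters of
all vertices at once within its conjugacy class. So length is a sum of vertex counts
(`classLength_eq_sum`). A Whitehead automorphism (P, m) acts on cyclically reduced words by an
explicit rewriting that keeps them cyclically reduced. It changes only the count of m, and the new
count is the number of times the cyclic word crosses between P and its opposite side. Crossing
numbers behave like cut functions: replacing P and Q by their intersection and the intersection of
their opposite sides does not increase the total (`WeakPair.classCount_inter_add_le`).

Peaks: suppose two moves from σ do not raise the height and one of them lowers it. Then their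
targets are joined by moves through complexes lower than σ (`WeakPair.lowPath`). If the
automorphisms satisfy a commutation-type relation, the fourth corner of a square is low; otherwise
submodularity supplies an intermediate set that lowers the height.

Conclusion: the generators of Out_ℓ are Whitehead automorphisms up to isomorphisms of the Salvetti
complex, so a path of moves joins `marked 1` to σ. A move from `marked 1` that does not raise the
height is trivial (`WeakMove.eq_of_height_le`). Removing peaks and trivial first steps terminates
with a path of strictly increasing height, and its last step, reversed, lowers σ. -/

@[simp] theorem Sgn.inv_inv (x : Sgn V) : x.inv.inv = x := by simp [Sgn.inv]

@[simp] theorem Sgn.inv_fst (x : Sgn V) : x.inv.1 = x.1 := rfl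

@[simp] theorem Sgn.inv_snd (x : Sgn V) : x.inv.2 = !x.2 := rfl

theorem Sgn.inv_ne (x : Sgn V) : x.inv ≠ x := fun h => by
  have := congrArg Prod.snd h
  simp at this

theorem Sgn.ne_inv (x : Sgn V) : x ≠ x.inv := (Sgn.inv_ne x).symm

theorem Sgn.inv_eq_iff {x y : Sgn V} : x.inv = y ↔ x = y.inv :=
  ⟨fun h => by rw [← h, Sgn.inv_inv], fun h => by rw [h, Sgn.inv_inv]⟩

theorem Sgn.eq_or_eq_inv {x y : Sgn V} (h : x.1 = y.1) : x = y ∨ x = y.inv := by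
  obtain ⟨v, s⟩ := x
  obtain ⟨w, t⟩ := y
  obtain rfl : v = w := h
  cases s <;> cases t <;> simp [Sgn.inv]

theorem gen_commute {v w : V} (h : Γ.Adj v w) : Commute (gen Γ v) (gen Γ w) := by
  have h1 : PresentedGroup.mk (relators Γ)
      (FreeGroup.of v * FreeGroup.of w * (FreeGroup.of v)⁻¹ * (FreeGroup.of w)⁻¹) = 1 :=
    PresentedGroup.one_of_mem ⟨v, w, h, rfl⟩
  simp only [map_mul, map_inv] at h1
  change gen Γ v * gen Γ w * (gen Γ v)⁻¹ * (gen Γ w)⁻¹ = 1 at h1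
  rw [mul_inv_eq_one, mul_inv_eq_iff_eq_mul] at h1
  exact h1

theorem letter_commute {x y : Sgn V} (h : Γ.Adj x.1 y.1) :
    Commute (letter Γ x) (letter Γ y) := by
  unfold letter
  have := gen_commute h
  split_ifs
  · exact this
  · exact this.inv_right
  · exact this.inv_left
  · exact this.inv_left.inv_right

@[simp] theorem wordVal_nil : wordVal Γ [] = 1 := rfl

@[simp] theorem wordVal_cons (x : Sgn V) (w : List (Sgn V)) :
    wordVal Γ (x :: w) = letter Γ x * wordVal Γ w := by simp [wordVal]

@[simp] theorem wordVal_append (w u : List (Sgn V)) :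
    wordVal Γ (w ++ u) = wordVal Γ w * wordVal Γ u := by simp [wordVal]

theorem exists_wordVal_eq (a : RAAG Γ) : ∃ w, wordVal Γ w = a := by
  have : a ∈ (⊤ : Subgroup (RAAG Γ)) := trivial
  rw [← PresentedGroup.closure_range_of (relators Γ)] at this
  induction this using Subgroup.closure_induction with
  | mem a ha =>
    obtain ⟨v, rfl⟩ := ha
    exact ⟨[(v, true)], by simp [letter, gen]⟩
  | one => exact ⟨[], rfl⟩
  | mul a b _ _ ha hb =>
    obtain ⟨u, rfl⟩ := ha
    obtain ⟨w, rfl⟩ := hb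
    exact ⟨u ++ w, by simp⟩
  | inv a _ ha =>
    obtain ⟨u, rfl⟩ := ha
    clear * -
    induction u with
    | nil => exact ⟨[], by simp⟩
    | cons x u ih =>
      obtain ⟨w, hw⟩ := ih
      exact ⟨w ++ [x.inv], by simp [hw, letter_inv]⟩

/-- The letter `x⁻¹` occurs in the word and commutes with all letters before it. -/
def Cancels (Γ : SimpleGraph V) (x : Sgn V) : List (Sgn V) → Prop
  | [] => False
  | y :: w => y = x.inv ∨ (Γ.Adj x.1 y.1 ∧ Cancels Γ x w)

/-- Words without a subword `x u x⁻¹` in which `x` is adjacent to all letters of `u`. -/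
def Reduced (Γ : SimpleGraph V) : List (Sgn V) → Prop
  | [] => True
  | x :: w => ¬ Cancels Γ x w ∧ Reduced Γ w

open Classical in
/-- The number of letters of a word that belong to a vertex. -/
noncomputable def wcount (v : V) (w : List (Sgn V)) : ℕ := w.countP fun x => x.1 = v

@[simp] theorem wcount_nil (v : V) : wcount v [] = 0 := rfl

open Classical in
theorem wcount_cons (v : V) (x : Sgn V) (w : List (Sgn V)) :
    wcount v (x :: w) = wcount v w + if x.1 = v then 1 else 0 := by
  simp [wcount, List.countP_cons]

@[simp] theorem wcount_append (v : V) (w u : List (Sgn V)) :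
    wcount v (w ++ u) = wcount v w + wcount v u := by simp [wcount]

theorem length_eq_sum_wcount [Fintype V] (w : List (Sgn V)) : w.length = ∑ v, wcount v w := by
  classical
  induction w with
  | nil => simp
  | cons x w ih => simp [wcount_cons, Finset.sum_add_distrib, ih]

theorem Cancels.exists_shorter {x : Sgn V} {w : List (Sgn V)} (h : Cancels Γ x w) :
    ∃ u, u.length + 1 = w.length ∧ wordVal Γ u = letter Γ x * wordVal Γ w := by
  induction w with
  | nil => exact h.elim
  | cons y w ih =>
    rcases h with rfl | ⟨h1, h2⟩
    · exact ⟨w, rfl, by simp [letter_inv]⟩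
    · obtain ⟨u, hu, hv⟩ := ih h2
      refine ⟨y :: u, by simp [hu], ?_⟩
      rw [wordVal_cons, hv, wordVal_cons, ← mul_assoc, ← mul_assoc, (letter_commute h1).eq]

theorem exists_shorter_of_not_reduced {w : List (Sgn V)} (h : ¬ Reduced Γ w) :
    ∃ u, u.length < w.length ∧ wordVal Γ u = wordVal Γ w := by
  induction w with
  | nil => exact (h trivial).elim
  | cons x w ih =>
    by_cases h1 : Cancels Γ x w
    · obtain ⟨u, hu, hv⟩ := h1.exists_shorter
      exact ⟨u, by simp; omega, by simp [hv]⟩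
    · obtain ⟨u, hu, hv⟩ := ih fun h2 => h ⟨h1, h2⟩
      exact ⟨x :: u, by simpa using hu, by simp [hv]⟩

/-- A vertex is not adjacent to itself, so a second occurrence of `x` blocks the search for `x⁻¹`.
-/
theorem Cancels.of_append_cons {x : Sgn V} {u w : List (Sgn V)}
    (h : Cancels Γ x (u ++ x :: w)) : Cancels Γ x u := by
  induction u with
  | nil =>
    rcases h with h | h
    · exact absurd h x.ne_inv
    · exact absurd h.1 (Γ.irrefl)
  | cons y u ih => exact h.imp id fun h => ⟨h.1, ih h.2⟩

theorem reduced_of_forall_inv_notMem {w : List (Sgn V)} (h : ∀ x ∈ w, x.inv ∉ w) :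
    Reduced Γ w := by
  have key : ∀ (x : Sgn V) (w : List (Sgn V)), Cancels Γ x w → x.inv ∈ w := by
    intro x w
    induction w with
    | nil => exact False.elim
    | cons y w ih =>
      rintro (rfl | h)
      · simp
      · exact List.mem_cons_of_mem _ (ih h.2)
  induction w with
  | nil => trivial
  | cons x w ih =>
    refine ⟨fun hc => h x (by simp) (List.mem_cons_of_mem _ (key x w hc)), ih fun y hy hy' => ?_⟩
    exact h y (List.mem_cons_of_mem _ hy) (List.mem_cons_of_mem _ hy')

/-! ### Pilings -/

/-- A piling: a stack over every vertex, of signs and of blanks. -/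
abbrev Piling (V : Type*) : Type _ := V → List (Option Bool)

open Classical in
/-- Put a letter on a piling: its sign on its own stack, a blank on the stacks of the other
vertices which are not adjacent to it. -/
noncomputable def pilePush (Γ : SimpleGraph V) (x : Sgn V) (p : Piling V) : Piling V := fun v =>
  if Γ.Adj x.1 v then p v else (if v = x.1 then some x.2 else none) :: p v

open Classical in
/-- Remove the top of the stacks of the vertices which are not adjacent to a letter. -/
noncomputable def pilePop (Γ : SimpleGraph V) (x : Sgn V) (p : Piling V) : Piling V := fun v =>
  if Γ.Adj x.1 v then p v else (p v).tail

/-- A letter is on top of its stack. -/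
def PileTop (p : Piling V) (x : Sgn V) : Prop := (p x.1).head? = some (some x.2)

open Classical in
/-- The action of a letter on pilings. -/
noncomputable def pileAct (Γ : SimpleGraph V) (x : Sgn V) (p : Piling V) : Piling V :=
  if PileTop p x.inv then pilePop Γ x p else pilePush Γ x p

/-- The pilings of reduced words. -/
inductive PileReach (Γ : SimpleGraph V) : Piling V → Prop
  | empty : PileReach Γ fun _ => []
  | push (x : Sgn V) (p : Piling V) : PileReach Γ p → ¬ PileTop p x.inv →
      PileReach Γ (pilePush Γ x p)

@[simp] theorem pilePop_pilePush (x : Sgn V) (p : Piling V) :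
    pilePop Γ x (pilePush Γ x p) = p := by
  ext1 v
  by_cases h : Γ.Adj x.1 v <;> simp [pilePop, pilePush, h]

theorem pilePop_inv (x : Sgn V) (p : Piling V) : pilePop Γ x.inv p = pilePop Γ x p := rfl

theorem pileTop_push_self (x : Sgn V) (p : Piling V) : PileTop (pilePush Γ x p) x := by
  simp [PileTop, pilePush]

theorem pileTop_push_adj {x y : Sgn V} (h : Γ.Adj x.1 y.1) (p : Piling V) :
    PileTop (pilePush Γ x p) y ↔ PileTop p y := by
  simp [PileTop, pilePush, h]

theorem pileTop_push_of_not_adj {x y : Sgn V} (h : ¬ Γ.Adj x.1 y.1) (p : Piling V) :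
    PileTop (pilePush Γ x p) y ↔ y = x := by
  obtain ⟨v, s⟩ := x
  obtain ⟨w, t⟩ := y
  by_cases hv : w = v
  · subst hv
    simp [PileTop, pilePush, eq_comm]
  · have h' : ¬ Γ.Adj v w := h
    simp [PileTop, pilePush, h', hv]

theorem pilePush_comm {x y : Sgn V} (h : Γ.Adj x.1 y.1) (p : Piling V) :
    pilePush Γ x (pilePush Γ y p) = pilePush Γ y (pilePush Γ x p) := by
  ext1 v
  by_cases h1 : Γ.Adj x.1 v <;> by_cases h2 : Γ.Adj y.1 v <;> simp [pilePush, h1, h2]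
  have h3 : v ≠ x.1 := fun e => h2 (e ▸ h.symm)
  have h4 : v ≠ y.1 := fun e => h1 (e ▸ h)
  simp [h3, h4]

/-- Any push of a letter not adjacent to `y` covers the stack of `y`. So everything pushed after a
visible `y` is adjacent to it, and `y` can be commuted to the end. -/
theorem PileReach.exists_of_top {p : Piling V} (hp : PileReach Γ p) {y : Sgn V}
    (hy : PileTop p y) : ∃ q, PileReach Γ q ∧ ¬ PileTop q y.inv ∧ p = pilePush Γ y q := by
  induction hp with
  | empty => simp [PileTop] at hy
  | push x p hp hx ih =>
    by_cases h : Γ.Adj x.1 y.1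
    · obtain ⟨q, hq, hq', rfl⟩ := ih ((pileTop_push_adj h p).1 hy)
      refine ⟨pilePush Γ x q, .push x q hq ?_, ?_, pilePush_comm h q⟩
      · rwa [pileTop_push_adj (by exact h.symm)] at hx
      · rwa [pileTop_push_adj (by exact h)]
    · rw [pileTop_push_of_not_adj h] at hy
      subst hy
      exact ⟨p, hp, hx, rfl⟩

theorem pileAct_push_inv {x : Sgn V} (q : Piling V) :
    pileAct Γ x (pilePush Γ x.inv q) = q := by
  rw [pileAct, if_pos (pileTop_push_self _ _), ← pilePop_inv, pilePop_pilePush]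

theorem pileAct_of_not_top {x : Sgn V} {p : Piling V} (h : ¬ PileTop p x.inv) :
    pileAct Γ x p = pilePush Γ x p := if_neg h

theorem PileReach.act {p : Piling V} (hp : PileReach Γ p) (x : Sgn V) :
    PileReach Γ (pileAct Γ x p) := by
  by_cases h : PileTop p x.inv
  · obtain ⟨q, hq, -, rfl⟩ := hp.exists_of_top h
    rwa [pileAct_push_inv]
  · rw [pileAct_of_not_top h]
    exact .push x p hp h

/-- Popping deletes the tops of all non-adjacent stacks without inspecting them. On reachable
pilings these are exactly the entries of one earlier push, which is why the action is restricted to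
them. -/
theorem PileReach.act_act_inv {p : Piling V} (hp : PileReach Γ p) (x : Sgn V) :
    pileAct Γ x (pileAct Γ x.inv p) = p := by
  by_cases h : PileTop p x
  · obtain ⟨q, hq, hq', rfl⟩ := hp.exists_of_top h
    have := pileAct_push_inv (Γ := Γ) (x := x.inv) q
    rw [Sgn.inv_inv] at this
    rw [this, pileAct_of_not_top hq']
  · rw [pileAct_of_not_top (x := x.inv) (by simpa using h), pileAct_push_inv]

theorem PileReach.act_comm {p : Piling V} (hp : PileReach Γ p) {x y : Sgn V}
    (h : Γ.Adj x.1 y.1) :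
    pileAct Γ x (pileAct Γ y p) = pileAct Γ y (pileAct Γ x p) := by
  have hxy : Γ.Adj x.inv.1 y.inv.1 := h
  have hx : Γ.Adj x.inv.1 y.1 := h
  have hy : Γ.Adj x.1 y.inv.1 := h
  by_cases h1 : PileTop p x.inv
  · obtain ⟨q, hq, hq', rfl⟩ := hp.exists_of_top h1
    rw [pileAct_push_inv]
    by_cases h2 : PileTop q y.inv
    · obtain ⟨r, hr, hr', rfl⟩ := hq.exists_of_top h2
      rw [pilePush_comm hxy, pileAct_push_inv, pileAct_push_inv, pileAct_push_inv]
    · rw [pileAct_of_not_top (x := y) (p := pilePush Γ x.inv q), pilePush_comm hx.symm,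
        pileAct_push_inv, pileAct_of_not_top h2]
      rwa [pileTop_push_adj hxy]
  · rw [pileAct_of_not_top h1]
    by_cases h2 : PileTop p y.inv
    · obtain ⟨q, hq, hq', rfl⟩ := hp.exists_of_top h2
      rw [pilePush_comm hy, pileAct_push_inv, pileAct_push_inv, pileAct_of_not_top]
      rwa [pileTop_push_adj hxy.symm] at h1
    · rw [pileAct_of_not_top h2, pileAct_of_not_top, pileAct_of_not_top, pilePush_comm h]
      · rwa [pileTop_push_adj hy]
      · rwa [pileTop_push_adj hx.symm]

/-- The permutation of the pilings of reduced words given by a letter. -/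
noncomputable def pilePerm (Γ : SimpleGraph V) (x : Sgn V) : Equiv.Perm {p // PileReach Γ p} where
  toFun p := ⟨pileAct Γ x p.1, p.2.act x⟩
  invFun p := ⟨pileAct Γ x.inv p.1, p.2.act x.inv⟩
  left_inv p := Subtype.ext (by simpa using p.2.act_act_inv x.inv)
  right_inv p := Subtype.ext (p.2.act_act_inv x)

theorem pilePerm_inv (x : Sgn V) : pilePerm Γ x.inv = (pilePerm Γ x)⁻¹ := by
  ext p : 1
  rfl

/-- The action of the right-angled Artin group on the pilings of reduced words. -/
noncomputable def pileHom (Γ : SimpleGraph V) : RAAG Γ →* Equiv.Perm {p // PileReach Γ p} :=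
  PresentedGroup.toGroup (f := fun v => pilePerm Γ (v, true)) (by
    rintro _ ⟨v, w, h, rfl⟩
    simp only [map_mul, map_inv, FreeGroup.lift_apply_of]
    rw [mul_inv_eq_one, mul_inv_eq_iff_eq_mul]
    ext p : 1
    exact Subtype.ext (p.2.act_comm (x := (v, true)) (y := (w, true)) h))

theorem pileHom_letter (x : Sgn V) : pileHom Γ (letter Γ x) = pilePerm Γ x := by
  have h : ∀ v, pileHom Γ (gen Γ v) = pilePerm Γ (v, true) := fun v =>
    PresentedGroup.toGroup.of _
  obtain ⟨v, _ | _⟩ := x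
  · have : ((v, false) : Sgn V) = Sgn.inv (v, true) := rfl
    rw [this, letter_inv, map_inv, pilePerm_inv]
    simp [letter, h]
  · simp [letter, h]

/-- The piling of a word. -/
noncomputable def pileOf (Γ : SimpleGraph V) : List (Sgn V) → Piling V
  | [] => fun _ => []
  | x :: w => pileAct Γ x (pileOf Γ w)

theorem pileHom_wordVal (w : List (Sgn V)) :
    (pileHom Γ (wordVal Γ w) ⟨fun _ => [], .empty⟩).1 = pileOf Γ w := by
  induction w with
  | nil => simp [pileOf]
  | cons x w ih =>
    rw [wordVal_cons, map_mul, Equiv.Perm.mul_apply, pileHom_letter]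
    change pileAct Γ x _ = _
    rw [ih, pileOf]

theorem count_pilePush (x : Sgn V) (p : Piling V) (v : V) (w : List (Sgn V)) :
    (pilePush Γ x p v).countP Option.isSome + wcount v w =
      (p v).countP Option.isSome + wcount v (x :: w) := by
  rw [wcount_cons]
  by_cases h : v = x.1
  · subst h
    simp [pilePush]
    omega
  · have h' : x.1 ≠ v := fun e => h e.symm
    by_cases h1 : Γ.Adj x.1 v <;> simp [pilePush, h, h', h1]

theorem count_pileOf_le (v : V) (w : List (Sgn V)) :
    (pileOf Γ w v).countP Option.isSome ≤ wcount v w := by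
  induction w with
  | nil => simp [pileOf]
  | cons x w ih =>
    by_cases h : PileTop (pileOf Γ w) x.inv
    · rw [pileOf, pileAct, if_pos h, wcount_cons]
      have : (pilePop Γ x (pileOf Γ w) v).countP Option.isSome ≤
          (pileOf Γ w v).countP Option.isSome := by
        unfold pilePop
        split_ifs
        · exact le_rfl
        · exact (List.tail_sublist _).countP_le
      omega
    · rw [pileOf, pileAct_of_not_top h]
      have := count_pilePush (Γ := Γ) x (pileOf Γ w) v w
      omega

/-- For a reduced word nothing is ever popped. The two claims need a joint induction: the
description of the tops shows that the next letter is pushed. -/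
theorem Reduced.pileOf_aux {w : List (Sgn V)} (hw : Reduced Γ w) :
    (∀ v, (pileOf Γ w v).countP Option.isSome = wcount v w) ∧
      ∀ x, PileTop (pileOf Γ w) (Sgn.inv x) ↔ Cancels Γ x w := by
  induction w with
  | nil => simp [pileOf, PileTop, Cancels]
  | cons y w ih =>
    obtain ⟨h1, h2⟩ := ih hw.2
    have h3 : ¬ PileTop (pileOf Γ w) y.inv := by
      rw [h2]
      exact hw.1
    rw [pileOf, pileAct_of_not_top h3]
    refine ⟨fun v => ?_, fun x => ?_⟩
    · have := count_pilePush (Γ := Γ) y (pileOf Γ w) v w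
      have := h1 v
      omega
    · by_cases h : Γ.Adj x.1 y.1
      · rw [pileTop_push_adj (by exact h.symm), h2]
        have : y ≠ x.inv := by
          rintro rfl
          exact Γ.irrefl h
        simp [Cancels, this, h]
      · rw [pileTop_push_of_not_adj (y := x.inv) (fun e => h e.symm)]
        simp [Cancels, h, eq_comm]

/-- The piling depends only on the group element. Its signs over `v` number exactly the letters of
`v` in a reduced word, and at most those in any word. -/
theorem Reduced.wcount_le {w u : List (Sgn V)} (hw : Reduced Γ w)
    (h : wordVal Γ w = wordVal Γ u) (v : V) : wcount v w ≤ wcount v u := by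
  rw [← hw.pileOf_aux.1 v, ← pileHom_wordVal, h, pileHom_wordVal]
  exact count_pileOf_le v u

/-! ### Cyclically reduced words -/

/-- The powers of a word. -/
def wordPow (k : ℕ) (w : List (Sgn V)) : List (Sgn V) := (List.replicate k w).flatten

@[simp] theorem wordPow_zero (w : List (Sgn V)) : wordPow 0 w = [] := rfl

theorem wordPow_succ (k : ℕ) (w : List (Sgn V)) : wordPow (k + 1) w = w ++ wordPow k w := by
  simp [wordPow, List.replicate_succ]

theorem wordVal_wordPow (k : ℕ) (w : List (Sgn V)) :
    wordVal Γ (wordPow k w) = wordVal Γ w ^ k := by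
  induction k with
  | zero => simp
  | succ k ih => rw [wordPow_succ, wordVal_append, ih, pow_succ']

theorem wcount_wordPow (v : V) (k : ℕ) (w : List (Sgn V)) :
    wcount v (wordPow k w) = k * wcount v w := by
  induction k with
  | zero => simp
  | succ k ih => rw [wordPow_succ, wcount_append, ih]; ring

/-- Words all of whose powers are reduced. -/
def CycReduced (Γ : SimpleGraph V) (w : List (Sgn V)) : Prop := ∀ k, Reduced Γ (wordPow k w)

theorem le_of_forall_mul_le_add_mul {a b c : ℕ} (h : ∀ k, k * a ≤ c + k * b) : a ≤ b := by
  by_contra! hab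
  have := h (c + 1)
  nlinarith

/-- The k-th powers are conjugate by an element independent of `k`. The letters of the conjugating
words are a bounded error, which disappears as `k` grows. -/
theorem CycReduced.wcount_le {w u : List (Sgn V)} (hw : CycReduced Γ w)
    (h : ConjClasses.mk (wordVal Γ w) = ConjClasses.mk (wordVal Γ u)) (v : V) :
    wcount v w ≤ wcount v u := by
  obtain ⟨a, ha⟩ := isConj_iff.1 (ConjClasses.mk_eq_mk_iff_isConj.1 h.symm)
  obtain ⟨s, rfl⟩ := exists_wordVal_eq a
  obtain ⟨t, ht⟩ := exists_wordVal_eq (wordVal Γ s)⁻¹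
  refine le_of_forall_mul_le_add_mul (c := wcount v s + wcount v t) fun k => ?_
  have := (hw k).wcount_le (u := s ++ wordPow k u ++ t) (by
    rw [wordVal_append, wordVal_append, wordVal_wordPow, wordVal_wordPow, ht, ← ha, conj_pow]) v
  simp only [wcount_append, wcount_wordPow] at this
  omega

/-- A word of minimal length in the class works: its rotations have minimal length too, so they are
reduced, and a cancellation in a power would already occur within one rotation. -/
theorem exists_cycReduced (c : ConjClasses (RAAG Γ)) :
    ∃ w, CycReduced Γ w ∧ ConjClasses.mk (wordVal Γ w) = c := by
  obtain ⟨w0, hw0⟩ := exists_word Γ c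
  obtain ⟨w, hw, hc⟩ := Nat.sInf_mem
    (s := {n | ∃ w : List (Sgn V), w.length = n ∧ ConjClasses.mk (wordVal Γ w) = c})
    ⟨_, w0, rfl, hw0⟩
  have hmin : ∀ u, ConjClasses.mk (wordVal Γ u) = c → w.length ≤ u.length := fun u hu => by
    rw [hw]
    exact Nat.sInf_le ⟨u, rfl, hu⟩
  have hrot : ∀ a b, w = a ++ b → Reduced Γ (b ++ a) := by
    intro a b hab
    by_contra hr
    obtain ⟨u, hu, hv⟩ := exists_shorter_of_not_reduced hr
    have := hmin u (by
      rw [hv, ← hc, hab, ConjClasses.mk_eq_mk_iff_isConj, isConj_iff]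
      exact ⟨wordVal Γ a, by simp [mul_assoc]⟩)
    rw [hab] at this
    simp at hu this
    omega
  refine ⟨w, fun k => ?_, hc⟩
  have key : ∀ k, ∀ b a, w = a ++ b → Reduced Γ (b ++ wordPow k w) := by
    intro k
    induction k with
    | zero =>
      intro b a hab
      have := hrot a b hab
      clear hab
      induction b with
      | nil => trivial
      | cons y b ih =>
        have h0 : ∀ {y : Sgn V} {u s : List (Sgn V)}, Cancels Γ y u → Cancels Γ y (u ++ s) := by
          intro y u s h
          induction u with
          | nil => exact h.elim
          | cons z u ih => exact h.imp id fun h => ⟨h.1, ih h.2⟩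
        exact ⟨fun h => this.1 (by simpa using h0 (s := a) (by simpa using h)), ih this.2⟩
    | succ k ih =>
      intro b
      induction b with
      | nil =>
        intro a _
        simpa [wordPow_succ] using ih w [] rfl
      | cons y b ihb =>
        intro a hab
        refine ⟨fun h => ?_, ihb (a ++ [y]) (by simp [hab])⟩
        rw [wordPow_succ] at h
        -- The letter `y` recurs one period later and blocks any longer search, so the cancelling
        -- letter lies in `b ++ a`.
        have h1 : b ++ (w ++ wordPow k w) = (b ++ a) ++ y :: (b ++ wordPow k w) := by
          rw [hab]
          simp
        change Cancels Γ y (b ++ (w ++ wordPow k w)) at h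
        rw [h1] at h
        exact (hrot a (y :: b) hab).1 h.of_append_cons
  simpa using key k [] w (by simp)

/-- The minimal number of letters of a vertex in words representing a conjugacy class. -/
noncomputable def classCount (Γ : SimpleGraph V) (v : V) (c : ConjClasses (RAAG Γ)) : ℕ :=
  sInf {n | ∃ w : List (Sgn V), wcount v w = n ∧ ConjClasses.mk (wordVal Γ w) = c}

theorem classCount_le (v : V) (w : List (Sgn V)) :
    classCount Γ v (ConjClasses.mk (wordVal Γ w)) ≤ wcount v w :=
  Nat.sInf_le ⟨w, rfl, rfl⟩

theorem exists_wcount_eq_classCount (v : V) (c : ConjClasses (RAAG Γ)) :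
    ∃ w : List (Sgn V), wcount v w = classCount Γ v c ∧ ConjClasses.mk (wordVal Γ w) = c := by
  obtain ⟨w0, hw0⟩ := exists_word Γ c
  exact Nat.sInf_mem
    (s := {n | ∃ w : List (Sgn V), wcount v w = n ∧ ConjClasses.mk (wordVal Γ w) = c})
    ⟨_, w0, rfl, hw0⟩

theorem CycReduced.classCount_eq {w : List (Sgn V)} (hw : CycReduced Γ w) (v : V) :
    classCount Γ v (ConjClasses.mk (wordVal Γ w)) = wcount v w := by
  refine le_antisymm (classCount_le v w) ?_
  obtain ⟨u, hu, hc⟩ := exists_wcount_eq_classCount v (ConjClasses.mk (wordVal Γ w))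
  rw [← hu]
  exact hw.wcount_le hc.symm v

theorem classLength_le (w : List (Sgn V)) :
    classLength Γ (ConjClasses.mk (wordVal Γ w)) ≤ w.length :=
  Nat.sInf_le ⟨w, rfl, rfl⟩

theorem CycReduced.classLength_eq [Fintype V] {w : List (Sgn V)} (hw : CycReduced Γ w) :
    classLength Γ (ConjClasses.mk (wordVal Γ w)) = w.length := by
  refine le_antisymm (classLength_le w) ?_
  refine le_csInf ⟨_, w, rfl, rfl⟩ ?_
  rintro _ ⟨u, rfl, hu⟩
  rw [length_eq_sum_wcount, length_eq_sum_wcount u]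
  exact Finset.sum_le_sum fun v _ => hw.wcount_le hu.symm v

/-- A single cyclically reduced word attains all the minima simultaneously. -/
theorem classLength_eq_sum [Fintype V] (c : ConjClasses (RAAG Γ)) :
    classLength Γ c = ∑ v, classCount Γ v c := by
  obtain ⟨w, hw, rfl⟩ := exists_cycReduced c
  rw [hw.classLength_eq, length_eq_sum_wcount]
  exact Finset.sum_congr rfl fun v _ => (hw.classCount_eq v).symm

end Words

/-! ### Whitehead automorphisms -/

section Whitehead

variable {V : Type*} {Γ : SimpleGraph V}

/-- Whitehead pairs in which the set may consist of the base letter alone. Conditions (2) and (3)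
on Whitehead pairs are merged into the condition `closed`. -/
structure WeakPair (Γ : SimpleGraph V) (P : Set (Sgn V)) (m : Sgn V) : Prop where
  mem : m ∈ P
  inv_notMem : m.inv ∉ P
  not_adj : ∀ x ∈ P, ¬ Γ.Adj x.1 m.1
  closed : ∀ x ∈ P, ∀ y : Sgn V, Γ.Adj x.1 y.1 → ¬ Γ.Adj y.1 m.1 → x.inv ∈ P ∧ y ∈ P

/-- The other side of the partition of the letters not adjacent to `m` that is given by `P`. -/
def coside (Γ : SimpleGraph V) (P : Set (Sgn V)) (m : Sgn V) : Set (Sgn V) :=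
  {x | ¬ Γ.Adj x.1 m.1 ∧ x ∉ P}

variable {P Q : Set (Sgn V)} {m n : Sgn V}

theorem WeakPair.notMem_of_adj (h : WeakPair Γ P m) {x : Sgn V} (hx : Γ.Adj x.1 m.1) :
    x ∉ P ∧ x.inv ∉ P :=
  ⟨fun hP => h.not_adj x hP hx, fun hP => h.not_adj _ hP hx⟩

theorem WeakPair.mem_iff_inv (h : WeakPair Γ P m) {x y : Sgn V} (hxy : Γ.Adj x.1 y.1)
    (hy : ¬ Γ.Adj y.1 m.1) : x.inv ∈ P ↔ x ∈ P :=
  ⟨fun hP => by simpa using (h.closed x.inv hP y hxy hy).1, fun hP => (h.closed x hP y hxy hy).1⟩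

theorem WeakPair.mem_iff_of_adj (h : WeakPair Γ P m) {x y : Sgn V} (hxy : Γ.Adj x.1 y.1)
    (hx : ¬ Γ.Adj x.1 m.1) (hy : ¬ Γ.Adj y.1 m.1) : y ∈ P ↔ x ∈ P :=
  ⟨fun hP => (h.closed y hP x hxy.symm hx).2, fun hP => (h.closed x hP y hxy hy).2⟩

theorem WeakPair.opposite (h : WeakPair Γ P m) : WeakPair Γ (coside Γ P m) m.inv where
  mem := ⟨Γ.irrefl, h.inv_notMem⟩
  inv_notMem hm := hm.2 (by simpa using h.mem)
  not_adj x hx := hx.1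
  closed := by
    rintro x ⟨hx, hxP⟩ y hxy hy
    refine ⟨⟨hx, ?_⟩, hy, ?_⟩
    · rwa [h.mem_iff_inv hxy hy]
    · rwa [h.mem_iff_of_adj hxy hx hy]

theorem WeakPair.singleton (Γ : SimpleGraph V) (m : Sgn V) : WeakPair Γ {m} m where
  mem := rfl
  inv_notMem h := m.inv_ne h
  not_adj := by
    rintro _ rfl
    exact Γ.irrefl
  closed := by
    rintro _ rfl y h h'
    exact (h' h.symm).elim

/-- The difference of two sets with the same base, together with the inverse of the base. -/
theorem WeakPair.sdiff (h : WeakPair Γ P m) (h' : WeakPair Γ Q m) :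
    WeakPair Γ (insert m.inv (Q \ P)) m.inv where
  mem := by simp
  inv_notMem := by simp [h.mem, m.ne_inv]
  not_adj := by
    rintro x (rfl | hx)
    · exact Γ.irrefl
    · exact h'.not_adj x hx.1
  closed := by
    rintro x (rfl | ⟨hQ, hP⟩) y hxy hy
    · exact (hy hxy.symm).elim
    · have hx := h'.not_adj x hQ
      refine ⟨.inr ⟨?_, ?_⟩, .inr ⟨?_, ?_⟩⟩
      · rwa [h'.mem_iff_inv hxy hy]
      · rwa [h.mem_iff_inv hxy hy]
      · rwa [h'.mem_iff_of_adj hxy hx hy]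
      · rwa [h.mem_iff_of_adj hxy hx hy]

/-- If `Q` separates `m` from `m⁻¹` then the link of `m` is contained in that of the base. -/
theorem WeakPair.adj_of_adj (h : WeakPair Γ Q n) (hm : m ∈ Q) (hm' : m.inv ∉ Q) {y : V}
    (hy : Γ.Adj y m.1) : Γ.Adj y n.1 := by
  by_contra hn
  exact hm' (h.closed m hm (y, true) hy.symm hn).1

/-- The intersection of two sides. -/
theorem WeakPair.inter (h : WeakPair Γ P m) (h' : WeakPair Γ Q n) (hmn : ¬ Γ.Adj m.1 n.1)
    (hm : m ∈ Q) (hn : n.inv ∉ P) : WeakPair Γ (P ∩ Q) m where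
  mem := ⟨h.mem, hm⟩
  inv_notMem hx := h.inv_notMem hx.1
  not_adj x hx := h.not_adj x hx.1
  closed := by
    rintro x ⟨hxP, hxQ⟩ y hxy hy
    obtain ⟨h1, h2⟩ := h.closed x hxP y hxy hy
    -- Otherwise closedness of `P` would carry membership from `y` to `n⁻¹`. With this excluded,
    -- both sets may be closed up along the same edge.
    have h3 : ¬ Γ.Adj y.1 n.1 := fun h3 =>
      hn (h.closed y h2 n.inv h3 fun e => hmn e.symm).2
    exact ⟨⟨h1, (h'.closed x hxQ y hxy h3).1⟩, h2, (h'.closed x hxQ y hxy h3).2⟩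

/-- The intersection of the opposite sides. -/
theorem WeakPair.inter_coside (h : WeakPair Γ P m) (h' : WeakPair Γ Q n)
    (hmn : ¬ Γ.Adj m.1 n.1) (hm : m ∈ Q) (hn : n.inv ∉ P) :
    WeakPair Γ (coside Γ P m ∩ coside Γ Q n) n.inv := by
  rw [Set.inter_comm]
  exact h'.opposite.inter h.opposite (fun e => hmn e.symm) ⟨fun e => hmn e.symm, hn⟩
    (fun e => e.2 (by simpa using hm))

/-- The union of two disjoint sets one of which contains the inverse of the base of the other. -/
theorem WeakPair.union_sdiff (h : WeakPair Γ P m) (h' : WeakPair Γ Q n)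
    (hmn : ¬ Γ.Adj m.1 n.1) (hd : Disjoint P Q) (hn : n.inv ∉ P) (hm : m.inv ∈ Q)
    (hne : m.1 ≠ n.1) :
    WeakPair Γ ((P ∪ Q) \ {m.inv}) n := by
  have hnP : n ∉ P := fun e => Set.disjoint_left.1 hd e h'.mem
  have hmQ : m ∉ Q := fun e => Set.disjoint_left.1 hd h.mem e
  have hlk : ∀ y, Γ.Adj y m.1 → Γ.Adj y n.1 := fun y hy =>
    h'.adj_of_adj (m := m.inv) hm (by simpa using hmQ) hy
  have hnm : ∀ x : Sgn V, x.1 ≠ m.1 → x ≠ m.inv := fun x hx e => hx (by rw [e]; rfl)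
  refine ⟨⟨.inr h'.mem, hnm _ fun e => hne e.symm⟩, fun e => ?_, ?_, ?_⟩
  · exact e.1.elim hn h'.inv_notMem
  · rintro x ⟨hx | hx, -⟩
    · intro hxn
      exact hnP (h.closed x hx n hxn fun e => hmn e.symm).2
    · exact h'.not_adj x hx
  · rintro x ⟨hx, hxm⟩ y hxy hy
    have hym : ¬ Γ.Adj y.1 m.1 := fun e => hy (hlk _ e)
    have hxn : ¬ Γ.Adj x.1 n.1 := by
      rcases hx with hx | hx
      · intro hxn
        exact hnP (h.closed x hx n hxn fun e => hmn e.symm).2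
      · exact h'.not_adj x hx
    have h1 : y ≠ m.inv := by
      rintro rfl
      exact hxn (hlk _ hxy)
    have h2 : x.inv ≠ m.inv := by
      intro e
      have : x = m := by simpa using congrArg Sgn.inv e
      exact hym (this ▸ hxy.symm)
    rcases hx with hx | hx
    · obtain ⟨h3, h4⟩ := h.closed x hx y hxy hym
      exact ⟨⟨.inl h3, h2⟩, .inl h4, h1⟩
    · obtain ⟨h3, h4⟩ := h'.closed x hx y hxy hy
      exact ⟨⟨.inr h3, h2⟩, .inr h4, h1⟩

/-- Change of the base. -/
theorem WeakPair.rebase (h : WeakPair Γ Q n) (hm : m ∈ Q) (hm' : m.inv ∉ Q)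
    (hlk : ∀ y, Γ.Adj y n.1 → Γ.Adj y m.1) : WeakPair Γ Q m := by
  have hlk' : ∀ y, Γ.Adj y m.1 → Γ.Adj y n.1 := fun y => h.adj_of_adj hm hm'
  exact ⟨hm, hm', fun x hx e => h.not_adj x hx (hlk' _ e),
    fun x hx y hxy hy => h.closed x hx y hxy fun e => hy (hlk _ e)⟩

/-- Closedness is a condition along single edges outside the star of `m`; following a walk gives the
condition on components. -/
theorem WeakPair.isWhiteheadPair (h : WeakPair Γ P m) (hP : P.Nontrivial) :
    IsWhiteheadPair Γ P m where
  nontrivial := hP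
  mem := h.mem
  inv_notMem := h.inv_notMem
  not_adj := h.not_adj
  single_le x hx hx' y hy := by
    by_contra hy'
    refine hx' (h.closed x hx (y, true) hy fun e => hy' (.inr ?_)).1
    exact e.symm
  double_comp v w hv hv' := by
    rintro ⟨hv1, hw1, ⟨p⟩⟩
    have key : ∀ (a b : ((st Γ m.1)ᶜ : Set V)), (Γ.induce (st Γ m.1)ᶜ).Walk a b →
        ((a.1, true) ∈ P ∧ (a.1, false) ∈ P) → ((b.1, true) ∈ P ∧ (b.1, false) ∈ P) := by
      intro a b p
      induction p with
      | nil => exact id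
      | @cons a b c hab _ ih =>
        intro ha
        have hb : ¬ Γ.Adj b.1 m.1 := fun e => b.2 (.inr e.symm)
        exact ih ⟨(h.closed (a.1, true) ha.1 (b.1, true) hab hb).2,
          (h.closed (a.1, true) ha.1 (b.1, false) hab hb).2⟩
    exact key _ _ p ⟨hv, hv'⟩

/-! ### The automorphism of a weak pair and its relations -/

open Classical in
/-- The letter `m` if `x ∈ P`, and `1` otherwise. -/
noncomputable def sideVal (Γ : SimpleGraph V) (P : Set (Sgn V)) (m x : Sgn V) : RAAG Γ :=
  if x ∈ P then letter Γ m else 1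

@[simp] theorem sideVal_of_mem {x : Sgn V} (h : x ∈ P) : sideVal Γ P m x = letter Γ m := if_pos h

@[simp] theorem sideVal_of_notMem {x : Sgn V} (h : x ∉ P) : sideVal Γ P m x = 1 := if_neg h

open Classical in
/-- The image of a letter under a Whitehead automorphism. -/
noncomputable def whImage (Γ : SimpleGraph V) (P : Set (Sgn V)) (m x : Sgn V) : RAAG Γ :=
  if x.1 = m.1 then (letter Γ x)⁻¹
  else sideVal Γ P m x.inv * letter Γ x * (sideVal Γ P m x)⁻¹

theorem whImage_inv (x : Sgn V) : whImage Γ P m x.inv = (whImage Γ P m x)⁻¹ := by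
  unfold whImage
  by_cases h : x.1 = m.1 <;> simp [h, letter_inv, mul_assoc]

theorem WeakPair.whImage_of_adj (h : WeakPair Γ P m) {x : Sgn V} (hx : Γ.Adj x.1 m.1) :
    whImage Γ P m x = letter Γ x := by
  have h1 : x.1 ≠ m.1 := fun e => Γ.irrefl (e ▸ hx)
  obtain ⟨h2, h3⟩ := h.notMem_of_adj hx
  simp [whImage, h1, h2, h3]

/-- If one of the vertices is adjacent to the base, its letter is fixed and commutes with everything
inserted. Otherwise closedness puts all four letters on one side, and both images are conjugated by
`m` or both are left alone. -/
theorem WeakPair.whImage_commute (h : WeakPair Γ P m) {x y : Sgn V} (hxy : Γ.Adj x.1 y.1) :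
    Commute (whImage Γ P m x) (whImage Γ P m y) := by
  have key : ∀ x y : Sgn V, Γ.Adj x.1 y.1 → Γ.Adj x.1 m.1 →
      Commute (whImage Γ P m x) (whImage Γ P m y) := by
    intro x y hxy hx
    rw [h.whImage_of_adj hx]
    have h1 := letter_commute hxy
    have h2 : ∀ z, Commute (letter Γ x) (sideVal Γ P m z) := fun z => by
      unfold sideVal
      split_ifs
      · exact letter_commute hx
      · exact Commute.one_right _
    unfold whImage
    split_ifs
    · exact h1.inv_right
    · exact ((h2 _).mul_right h1).mul_right (h2 _).inv_right
  by_cases hx : Γ.Adj x.1 m.1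
  · exact key x y hxy hx
  by_cases hy : Γ.Adj y.1 m.1
  · exact (key y x hxy.symm hy).symm
  have hx' : x.1 ≠ m.1 := fun e => hy (e ▸ hxy.symm)
  have hy' : y.1 ≠ m.1 := fun e => hx (e ▸ hxy)
  have h1 := h.mem_iff_inv hxy hy
  have h2 := h.mem_iff_of_adj hxy hx hy
  have h3 := h.mem_iff_inv hxy.symm hx
  by_cases hP : x ∈ P
  · rw [iff_true_right hP] at h1 h2
    rw [iff_true_right h2] at h3
    simp only [whImage, hx', hy', if_false, sideVal_of_mem hP, sideVal_of_mem h1,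
      sideVal_of_mem h2, sideVal_of_mem h3]
    exact (Commute.conj_iff _).2 (letter_commute hxy)
  · rw [iff_false_right hP] at h1 h2
    rw [iff_false_right h2] at h3
    simpa [whImage, hx', hy', hP, h1, h2, h3] using letter_commute hxy

theorem raagHom_ext {G : Type*} [Group G] {f g : RAAG Γ →* G}
    (h : ∀ x, f (letter Γ x) = g (letter Γ x)) : f = g := by
  ext v
  simpa [letter, gen] using h (v, true)

theorem raagAut_ext {f g : MulAut (RAAG Γ)} (h : ∀ x, f (letter Γ x) = g (letter Γ x)) :
    f = g := by
  have := raagHom_ext (f := (f : RAAG Γ →* RAAG Γ)) (g := (g : RAAG Γ →* RAAG Γ)) h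
  ext a
  exact DFunLike.congr_fun this a

/-- The Whitehead automorphism as an endomorphism. -/
noncomputable def WeakPair.hom (h : WeakPair Γ P m) : RAAG Γ →* RAAG Γ :=
  PresentedGroup.toGroup (f := fun v => whImage Γ P m (v, true)) (by
    rintro _ ⟨v, w, hvw, rfl⟩
    simp only [map_mul, map_inv, FreeGroup.lift_apply_of]
    rw [mul_inv_eq_one, mul_inv_eq_iff_eq_mul]
    exact h.whImage_commute (x := (v, true)) (y := (w, true)) hvw)

theorem WeakPair.hom_letter (h : WeakPair Γ P m) (x : Sgn V) :
    h.hom (letter Γ x) = whImage Γ P m x := by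
  have h1 : ∀ v, h.hom (gen Γ v) = whImage Γ P m (v, true) := fun v =>
    PresentedGroup.toGroup.of _
  obtain ⟨v, _ | _⟩ := x
  · have : ((v, false) : Sgn V) = Sgn.inv (v, true) := rfl
    rw [this, letter_inv, map_inv, whImage_inv, ← h1]
    simp [letter]
  · simp [letter, h1]

/-- Since the base is inverted, the factors inserted by the second application cancel those of the
first. -/
theorem WeakPair.hom_comp_hom (h : WeakPair Γ P m) : h.hom.comp h.hom = MonoidHom.id _ := by
  refine raagHom_ext fun x => ?_
  have h1 : h.hom (letter Γ m) = (letter Γ m)⁻¹ := by simp [h.hom_letter, whImage]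
  have h2 : ∀ y, h.hom (sideVal Γ P m y) = (sideVal Γ P m y)⁻¹ := fun y => by
    by_cases hy : y ∈ P <;> simp [hy, h1]
  by_cases hx : x.1 = m.1
  · have h3 : h.hom (letter Γ x) = (letter Γ x)⁻¹ := by simp [h.hom_letter, whImage, hx]
    simp [h3]
  · have h3 : h.hom (letter Γ x) =
        sideVal Γ P m x.inv * letter Γ x * (sideVal Γ P m x)⁻¹ := by
      simp [h.hom_letter, whImage, hx]
    simp only [MonoidHom.comp_apply, MonoidHom.id_apply]
    rw [h3, map_mul, map_mul, map_inv, h2, h2, h3]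
    group

/-- The Whitehead automorphism. -/
noncomputable def WeakPair.aut (h : WeakPair Γ P m) : MulAut (RAAG Γ) :=
  MonoidHom.toMulEquiv h.hom h.hom h.hom_comp_hom h.hom_comp_hom

theorem WeakPair.aut_letter (h : WeakPair Γ P m) {x : Sgn V} (hx : x.1 ≠ m.1) :
    h.aut (letter Γ x) = sideVal Γ P m x.inv * letter Γ x * (sideVal Γ P m x)⁻¹ := by
  change h.hom (letter Γ x) = _
  simp [h.hom_letter, whImage, hx]

theorem WeakPair.aut_letter_base (h : WeakPair Γ P m) {x : Sgn V} (hx : x.1 = m.1) :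
    h.aut (letter Γ x) = (letter Γ x)⁻¹ := by
  change h.hom (letter Γ x) = _
  simp [h.hom_letter, whImage, hx]

theorem WeakPair.aut_letter_fixed (h : WeakPair Γ P m) {x : Sgn V} (hx : x.1 ≠ m.1)
    (h1 : x ∉ P) (h2 : x.inv ∉ P) : h.aut (letter Γ x) = letter Γ x := by
  simp [h.aut_letter hx, h1, h2]

theorem WeakPair.aut_mul_aut (h : WeakPair Γ P m) : h.aut * h.aut = 1 := by
  ext a
  exact DFunLike.congr_fun h.hom_comp_hom a

theorem WeakPair.aut_inv (h : WeakPair Γ P m) : h.aut⁻¹ = h.aut :=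
  inv_eq_of_mul_eq_one_left h.aut_mul_aut

theorem WeakPair.aut_sideVal (h : WeakPair Γ P m) (R : Set (Sgn V)) (x : Sgn V) :
    h.aut (sideVal Γ R m x) = (sideVal Γ R m x)⁻¹ := by
  by_cases hx : x ∈ R <;> simp [hx, h.aut_letter_base]

theorem WeakPair.isWhiteheadAut (h : WeakPair Γ P m) : IsWhiteheadAut Γ P m h.aut where
  map_max := h.aut_letter_base rfl
  map_single x h1 h2 h3 := by simp [h.aut_letter h1, h2, h3]
  map_single' x h1 h2 h3 := by simp [h.aut_letter h1, h2, h3]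
  map_double x h1 h2 h3 := by simp [h.aut_letter h1, h2, h3]
  map_other x h1 h2 h3 := h.aut_letter_fixed h1 h2 h3

theorem outMk_eq_of_conj {f g : MulAut (RAAG Γ)} (a : RAAG Γ)
    (h : ∀ x, f (letter Γ x) = a * g (letter Γ x) * a⁻¹) : outMk f = outMk g := by
  have h1 : f = MulAut.conj a * g := raagAut_ext fun x => by simp [h]
  have h2 : outMk (MulAut.conj a) = 1 := (QuotientGroup.eq_one_iff _).2 ⟨a, rfl⟩
  rw [h1, map_mul, h2, one_mul]

/-- The two sides define the same outer automorphism. -/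
theorem WeakPair.outMk_opposite (h : WeakPair Γ P m) :
    outMk h.opposite.aut = outMk h.aut := by
  refine outMk_eq_of_conj (letter Γ m)⁻¹ fun x => ?_
  by_cases hx : x.1 = m.1
  · rw [h.aut_letter_base hx, h.opposite.aut_letter_base hx]
    rcases Sgn.eq_or_eq_inv hx with rfl | rfl <;> simp [letter_inv]
  · rw [h.aut_letter hx, h.opposite.aut_letter hx]
    by_cases hxm : Γ.Adj x.1 m.1
    · obtain ⟨h1, h2⟩ := h.notMem_of_adj hxm
      have h3 : x ∉ coside Γ P m := fun e => e.1 hxm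
      have h4 : x.inv ∉ coside Γ P m := fun e => e.1 hxm
      rw [sideVal_of_notMem h1, sideVal_of_notMem h2, sideVal_of_notMem h3, sideVal_of_notMem h4]
      have := (letter_commute hxm).inv_right.eq
      simp [← this]
    · have key : ∀ z : Sgn V, ¬ Γ.Adj z.1 m.1 → sideVal Γ (coside Γ P m) m.inv z =
          (letter Γ m)⁻¹ * sideVal Γ P m z := by
        intro z hz
        by_cases hP : z ∈ P
        · have : z ∉ coside Γ P m := fun e => e.2 hP
          simp [hP, this]
        · have : z ∈ coside Γ P m := ⟨hz, hP⟩
          simp [hP, this, letter_inv]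
      rw [key x hxm, key x.inv hxm]
      group

/-- Commuting Whitehead automorphisms. -/
theorem WeakPair.aut_commute (h : WeakPair Γ P m) (h' : WeakPair Γ Q n) (hne : m.1 ≠ n.1)
    (hm : m ∉ Q) (hm' : m.inv ∉ Q) (hn : n ∉ P) (hn' : n.inv ∉ P)
    (hc : ∀ x, Commute (sideVal Γ P m x) (sideVal Γ Q n x)) :
    h.aut * h'.aut = h'.aut * h.aut := by
  have h1 : ∀ x, h.aut (sideVal Γ Q n x) = sideVal Γ Q n x := fun x => by
    by_cases hx : x ∈ Q
    · simp [hx, h.aut_letter_fixed hne.symm hn hn']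
    · simp [hx]
  have h2 : ∀ x, h'.aut (sideVal Γ P m x) = sideVal Γ P m x := fun x => by
    by_cases hx : x ∈ P
    · simp [hx, h'.aut_letter_fixed hne hm hm']
    · simp [hx]
  refine raagAut_ext fun x => ?_
  simp only [MulAut.mul_apply]
  by_cases hx : x.1 = m.1
  · have h3 : h'.aut (letter Γ x) = letter Γ x := by
      refine h'.aut_letter_fixed (hx ▸ hne) ?_ ?_ <;>
      rcases Sgn.eq_or_eq_inv hx with rfl | rfl <;> simpa
    rw [h3, h.aut_letter_base hx, map_inv, h3]
  by_cases hx' : x.1 = n.1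
  · have h3 : h.aut (letter Γ x) = letter Γ x := by
      refine h.aut_letter_fixed hx ?_ ?_ <;>
      rcases Sgn.eq_or_eq_inv hx' with rfl | rfl <;> simpa
    rw [h3, h'.aut_letter_base hx', map_inv, h3]
  rw [h.aut_letter hx, h'.aut_letter hx']
  simp only [map_mul, map_inv, h1, h2]
  rw [h.aut_letter hx, h'.aut_letter hx']
  have e1 := (hc x.inv).eq
  have e2 := (hc x).eq
  calc _ = (sideVal Γ Q n x.inv * sideVal Γ P m x.inv) * letter Γ x *
        (sideVal Γ Q n x * sideVal Γ P m x)⁻¹ := by group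
    _ = _ := by rw [← e1, ← e2]; group

theorem WeakPair.aut_commute_of_adj (h : WeakPair Γ P m) (h' : WeakPair Γ Q n)
    (hmn : Γ.Adj m.1 n.1) : h.aut * h'.aut = h'.aut * h.aut := by
  obtain ⟨h1, h2⟩ := h'.notMem_of_adj hmn
  obtain ⟨h3, h4⟩ := h.notMem_of_adj hmn.symm
  refine h.aut_commute h' (fun e => Γ.irrefl (e ▸ hmn)) h1 h2 h3 h4 fun x => ?_
  by_cases hP : x ∈ P <;> by_cases hQ : x ∈ Q <;> simp [hP, hQ, letter_commute hmn]

theorem WeakPair.aut_commute_of_disjoint (h : WeakPair Γ P m) (h' : WeakPair Γ Q n)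
    (hne : m.1 ≠ n.1) (hd : Disjoint P Q) (hm : m.inv ∉ Q) (hn : n.inv ∉ P) :
    h.aut * h'.aut = h'.aut * h.aut := by
  refine h.aut_commute h' hne (Set.disjoint_left.1 hd h.mem) hm
    (Set.disjoint_right.1 hd h'.mem) hn fun x => ?_
  by_cases hP : x ∈ P
  · simp [hP, Set.disjoint_left.1 hd hP]
  · simp [hP]

/-- The relation for disjoint sets one of which contains the inverse of the other base. -/
theorem WeakPair.aut_mul_aut_mul_aut (h : WeakPair Γ P m) (h' : WeakPair Γ Q n)
    (hmn : ¬ Γ.Adj m.1 n.1) (hd : Disjoint P Q) (hn : n.inv ∉ P) (hm : m.inv ∈ Q)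
    (hne : m.1 ≠ n.1) :
    h.aut * h'.aut * h.aut = (h.union_sdiff h' hmn hd hn hm hne).aut := by
  have hnP : n ∉ P := fun e => Set.disjoint_left.1 hd e h'.mem
  have hmQ : m ∉ Q := fun e => Set.disjoint_left.1 hd h.mem e
  have hM : h'.aut (letter Γ m) = letter Γ n * letter Γ m := by
    simp [h'.aut_letter hne, hm, hmQ]
  have hM' : h.aut (letter Γ m) = (letter Γ m)⁻¹ := h.aut_letter_base rfl
  have hN : h.aut (letter Γ n) = letter Γ n := h.aut_letter_fixed hne.symm hnP hn
  refine raagAut_ext fun x => ?_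
  simp only [MulAut.mul_apply]
  by_cases hxn : x.1 = n.1
  · rw [WeakPair.aut_letter_base _ hxn]
    have h3 : h.aut (letter Γ x) = letter Γ x := by
      refine h.aut_letter_fixed (hxn ▸ hne.symm) ?_ ?_ <;>
      rcases Sgn.eq_or_eq_inv hxn with rfl | rfl <;> simpa
    rw [h3, h'.aut_letter_base hxn, map_inv, h3]
  rw [WeakPair.aut_letter _ hxn]
  by_cases hxm : x.1 = m.1
  · have e1 : m ∈ (P ∪ Q) \ {m.inv} := ⟨.inl h.mem, m.ne_inv⟩
    have e2 : m.inv ∉ (P ∪ Q) \ {m.inv} := by simp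
    rcases Sgn.eq_or_eq_inv hxm with rfl | rfl
    · rw [sideVal_of_mem e1, sideVal_of_notMem e2]
      simp [hM, hM', hN]
    · rw [Sgn.inv_inv, sideVal_of_mem e1, sideVal_of_notMem e2]
      simp [letter_inv, hM, hM', hN]
  have key : ∀ z : Sgn V, z.1 ≠ m.1 → h.aut (h'.aut (sideVal Γ P m z)) * sideVal Γ Q n z *
      sideVal Γ P m z = sideVal Γ ((P ∪ Q) \ {m.inv}) n z := by
    intro z hz
    have hz' : z ≠ m.inv := fun e => hz (by rw [e]; rfl)
    by_cases hP : z ∈ P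
    · have hQ := Set.disjoint_left.1 hd hP
      have e : z ∈ (P ∪ Q) \ {m.inv} := ⟨.inl hP, hz'⟩
      simp [hP, hQ, sideVal_of_mem e, hM, hM', hN]
    · by_cases hQ : z ∈ Q
      · have e : z ∈ (P ∪ Q) \ {m.inv} := ⟨.inr hQ, hz'⟩
        simp [hP, hQ, sideVal_of_mem e]
      · simp [hP, hQ]
  have hQ : ∀ z, h.aut (sideVal Γ Q n z) = sideVal Γ Q n z := fun z => by
    by_cases hz : z ∈ Q <;> simp [hz, hN]
  rw [← key x hxm, ← key x.inv hxm, h.aut_letter hxm]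
  simp only [map_mul, map_inv, h'.aut_letter hxn, h.aut_letter hxm, hQ]
  group

/-- The product of two Whitehead automorphisms with the same base and nested sets. -/
theorem WeakPair.aut_mul_aut_letter (h : WeakPair Γ P m) (h' : WeakPair Γ Q m) (hPQ : P ⊆ Q)
    {x : Sgn V} (hx : x.1 ≠ m.1) :
    (h.aut * h'.aut) (letter Γ x) =
      (sideVal Γ (Q \ P) m x.inv)⁻¹ * letter Γ x * sideVal Γ (Q \ P) m x := by
  have key : ∀ z, sideVal Γ (Q \ P) m z = (sideVal Γ P m z)⁻¹ * sideVal Γ Q m z := fun z => by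
    by_cases hP : z ∈ P
    · simp [hP, hPQ hP]
    · by_cases hQ : z ∈ Q <;> simp [hP, hQ]
  have key' : ∀ z, (sideVal Γ (Q \ P) m z)⁻¹ = (sideVal Γ Q m z)⁻¹ * sideVal Γ P m z :=
    fun z => by
    by_cases hP : z ∈ P
    · simp [hP, hPQ hP]
    · by_cases hQ : z ∈ Q <;> simp [hP, hQ]
  rw [key', key, MulAut.mul_apply, h'.aut_letter hx, map_mul, map_mul, map_inv, h.aut_sideVal,
    h.aut_sideVal, h.aut_letter hx]
  group

theorem WeakPair.aut_mul_aut_letter_base (h : WeakPair Γ P m) (h' : WeakPair Γ Q m)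
    {x : Sgn V} (hx : x.1 = m.1) : (h.aut * h'.aut) (letter Γ x) = letter Γ x := by
  rw [MulAut.mul_apply, h'.aut_letter_base hx, map_inv, h.aut_letter_base hx, inv_inv]

/-- Up to inverting the base, the product is again a Whitehead automorphism. So the results of two
nested moves with equal base are themselves one move apart. -/
theorem WeakPair.aut_nested (h : WeakPair Γ P m) (h' : WeakPair Γ Q m) (hPQ : P ⊆ Q) :
    h.aut * h'.aut = (h.sdiff h').aut * (WeakPair.singleton Γ m).aut := by
  refine raagAut_ext fun x => ?_
  by_cases hx : x.1 = m.1
  · rw [h.aut_mul_aut_letter_base h' hx, MulAut.mul_apply, WeakPair.aut_letter_base _ hx,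
      map_inv, WeakPair.aut_letter_base _ (by exact hx), inv_inv]
  · have hne : ∀ y : Sgn V, y.1 ≠ m.1 → y ∉ ({m} : Set (Sgn V)) := by
      rintro y hy rfl
      exact hy rfl
    have hne' : ∀ y : Sgn V, y.1 ≠ m.1 → sideVal Γ (insert m.inv (Q \ P)) m.inv y =
        (sideVal Γ (Q \ P) m y)⁻¹ := by
      intro y hy
      have h1 : y ≠ m.inv := fun e => hy (by rw [e]; rfl)
      by_cases h2 : y ∈ Q \ P
      · rw [sideVal_of_mem h2, sideVal_of_mem (Set.mem_insert_of_mem _ h2), letter_inv]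
      · rw [sideVal_of_notMem h2, sideVal_of_notMem fun e => e.elim h1 h2, inv_one]
    rw [h.aut_mul_aut_letter h' hPQ hx, MulAut.mul_apply,
      WeakPair.aut_letter_fixed _ hx (hne x hx) (hne x.inv hx),
      WeakPair.aut_letter _ (by exact hx), hne' x hx, hne' x.inv hx, inv_inv]

/-- The automorphism of a set that consists of the base alone is an inversion. -/
theorem isSalvettiIso_singleton (m : Sgn V) : IsSalvettiIso Γ (WeakPair.singleton Γ m).aut := by
  classical
  refine ⟨⟨fun x => if x.1 = m.1 then x.inv else x, fun x => if x.1 = m.1 then x.inv else x,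
    fun x => ?_, fun x => ?_⟩, fun x => ?_, fun x y => ?_, fun x => ?_⟩
  · by_cases h : x.1 = m.1 <;> simp [h]
  · by_cases h : x.1 = m.1 <;> simp [h]
  · by_cases h : x.1 = m.1 <;> simp [h]
  · by_cases h : x.1 = m.1 <;> by_cases h' : y.1 = m.1 <;> simp [h, h']
  · by_cases h : x.1 = m.1
    · rw [WeakPair.aut_letter_base _ h]
      simp [h, letter_inv]
    · have h1 : x ∉ ({m} : Set (Sgn V)) := fun e => h (by rw [Set.mem_singleton_iff.1 e])
      have h2 : x.inv ∉ ({m} : Set (Sgn V)) := fun e => h (by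
        rw [← Set.mem_singleton_iff.1 e]; rfl)
      rw [WeakPair.aut_letter_fixed _ h h1 h2]
      simp [h]

/-- The relation for two bases of the same set. -/
theorem WeakPair.exists_swap (h : WeakPair Γ Q m) (h' : WeakPair Γ Q n) (hne : m.1 ≠ n.1) :
    ∃ p : Equiv.Perm (Sgn V), (∀ x, p x.inv = (p x).inv) ∧
      (∀ x y, Γ.Adj (p x).1 (p y).1 ↔ Γ.Adj x.1 y.1) ∧
      (∀ x, (h.aut * h'.aut * h.aut) (letter Γ x) = letter Γ (p x)) ∧
      ∀ x, (p x).1 = n.1 ↔ x.1 = m.1 := by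
  classical
  have hmn : m ≠ n := fun e => hne (by rw [e])
  have hmn' : m ≠ n.inv := fun e => hne (by rw [e]; rfl)
  have hmn'' : m.inv ≠ n.inv := fun e => hmn (by simpa using congrArg Sgn.inv e)
  have hnm' : m.inv ≠ n := fun e => hne (by rw [← e]; rfl)
  have hM1 : h.aut (letter Γ m) = (letter Γ m)⁻¹ := h.aut_letter_base rfl
  have hN1 : h'.aut (letter Γ n) = (letter Γ n)⁻¹ := h'.aut_letter_base rfl
  have hM2 : h'.aut (letter Γ m) = letter Γ m * (letter Γ n)⁻¹ := by
    simp [h'.aut_letter hne, h.mem, h.inv_notMem]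
  have hN2 : h.aut (letter Γ n) = letter Γ n * (letter Γ m)⁻¹ := by
    simp [h.aut_letter hne.symm, h'.mem, h'.inv_notMem]
  set p : Equiv.Perm (Sgn V) := Equiv.swap m n * Equiv.swap m.inv n.inv with hp
  have p1 : p m = n := by
    rw [hp, Equiv.Perm.mul_apply, Equiv.swap_apply_of_ne_of_ne m.ne_inv hmn',
      Equiv.swap_apply_left]
  have p2 : p n = m := by
    rw [hp, Equiv.Perm.mul_apply, Equiv.swap_apply_of_ne_of_ne hnm'.symm n.ne_inv,
      Equiv.swap_apply_right]
  have p3 : p m.inv = n.inv := by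
    rw [hp, Equiv.Perm.mul_apply, Equiv.swap_apply_left,
      Equiv.swap_apply_of_ne_of_ne hmn'.symm n.inv_ne]
  have p4 : p n.inv = m.inv := by
    rw [hp, Equiv.Perm.mul_apply, Equiv.swap_apply_right,
      Equiv.swap_apply_of_ne_of_ne m.inv_ne hnm']
  have p5 : ∀ x : Sgn V, x.1 ≠ m.1 → x.1 ≠ n.1 → p x = x := by
    intro x h1 h2
    have a1 : x ≠ m := fun e => h1 (by rw [e])
    have a2 : x ≠ n := fun e => h2 (by rw [e])
    have a3 : x ≠ m.inv := fun e => h1 (by rw [e]; rfl)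
    have a4 : x ≠ n.inv := fun e => h2 (by rw [e]; rfl)
    rw [hp, Equiv.Perm.mul_apply, Equiv.swap_apply_of_ne_of_ne a3 a4,
      Equiv.swap_apply_of_ne_of_ne a1 a2]
  have cases : ∀ x : Sgn V, x = m ∨ x = m.inv ∨ x = n ∨ x = n.inv ∨ (x.1 ≠ m.1 ∧ x.1 ≠ n.1) := by
    intro x
    by_cases h1 : x.1 = m.1
    · have := Sgn.eq_or_eq_inv h1
      tauto
    · by_cases h2 : x.1 = n.1
      · have := Sgn.eq_or_eq_inv h2
        tauto
      · tauto
  have hlk : ∀ v, Γ.Adj m.1 v ↔ Γ.Adj n.1 v := fun v =>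
    ⟨fun e => (h'.adj_of_adj h.mem h.inv_notMem e.symm).symm,
      fun e => (h.adj_of_adj h'.mem h'.inv_notMem e.symm).symm⟩
  have hadj : ∀ x v, Γ.Adj (p x).1 v ↔ Γ.Adj x.1 v := by
    intro x v
    rcases cases x with rfl | rfl | rfl | rfl | ⟨h1, h2⟩
    · rw [p1, hlk]
    · rw [p3, Sgn.inv_fst, Sgn.inv_fst, hlk]
    · rw [p2, hlk]
    · rw [p4, Sgn.inv_fst, Sgn.inv_fst, hlk]
    · rw [p5 x h1 h2]
  refine ⟨p, fun x => ?_, fun x y => ?_, fun x => ?_, fun x => ?_⟩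
  · rcases cases x with rfl | rfl | rfl | rfl | ⟨h1, h2⟩
    · rw [p1, p3]
    · rw [p3, Sgn.inv_inv, Sgn.inv_inv, p1]
    · rw [p2, p4]
    · rw [p4, Sgn.inv_inv, Sgn.inv_inv, p2]
    · rw [p5 x h1 h2, p5 x.inv h1 h2]
  · rw [hadj, Γ.adj_comm, hadj, Γ.adj_comm]
  · simp only [MulAut.mul_apply]
    rcases cases x with rfl | rfl | rfl | rfl | ⟨h1, h2⟩
    · simp [p1, hM1, hM2, hN2]
    · simp [p3, letter_inv, hM1, hM2, hN2]
    · simp [p2, hN2, hN1, hM1, hM2]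
    · simp [p4, letter_inv, hN2, hN1, hM1, hM2]
    · have key : ∀ z, h.aut (h'.aut (sideVal Γ Q m z)) * h.aut (sideVal Γ Q n z) *
          sideVal Γ Q m z = 1 := by
        intro z
        by_cases hz : z ∈ Q
        · simp [hz, hM2, hN2, hM1]
        · simp [hz]
      rw [p5 x h1 h2, h.aut_letter h1]
      simp only [map_mul, map_inv, h'.aut_letter h2, h.aut_letter h1]
      calc _ = (h.aut (h'.aut (sideVal Γ Q m x.inv)) * h.aut (sideVal Γ Q n x.inv) *
            sideVal Γ Q m x.inv) * letter Γ x * (h.aut (h'.aut (sideVal Γ Q m x)) *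
            h.aut (sideVal Γ Q n x) * sideVal Γ Q m x)⁻¹ := by group
        _ = _ := by rw [key, key]; group
  · rcases cases x with rfl | rfl | rfl | rfl | ⟨h1, h2⟩
    · simp [p1]
    · simp [p3]
    · simp [p2, hne, hne.symm]
    · simp [p4, hne, hne.symm]
    · simp [p5 x h1 h2, h1, h2]

/-- Conjugation of a Whitehead automorphism by an automorphism permuting the letters. -/
theorem IsSalvettiIso.exists_conj {f : MulAut (RAAG Γ)} (hf : IsSalvettiIso Γ f)
    (h : WeakPair Γ P m) :
    ∃ (P' : Set (Sgn V)) (m' : Sgn V) (h' : WeakPair Γ P' m'), f * h.aut = h'.aut * f := by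
  obtain ⟨p, hp1, hp2, hp3⟩ := hf
  have hmem : ∀ x, p x ∈ p '' P ↔ x ∈ P := fun x => p.injective.mem_set_image
  have hfst : ∀ x y : Sgn V, (p x).1 = (p y).1 ↔ x.1 = y.1 := by
    intro x y
    constructor
    · intro e
      rcases Sgn.eq_or_eq_inv e with e | e
      · rw [p.injective e]
      · rw [← hp1] at e
        rw [p.injective e]
        rfl
    · intro e
      rcases Sgn.eq_or_eq_inv e with rfl | rfl
      · rfl
      · rw [hp1]
        rfl
  have h' : WeakPair Γ (p '' P) (p m) := by
    refine ⟨⟨m, h.mem, rfl⟩, ?_, ?_, ?_⟩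
    · rw [← hp1, hmem]
      exact h.inv_notMem
    · rintro _ ⟨x, hx, rfl⟩
      rw [hp2]
      exact h.not_adj x hx
    · rintro _ ⟨x, hx, rfl⟩ y hxy hy
      obtain ⟨y, rfl⟩ := p.surjective y
      rw [hp2] at hxy hy
      rw [← hp1, hmem, hmem]
      exact h.closed x hx y hxy hy
  refine ⟨p '' P, p m, h', raagAut_ext fun x => ?_⟩
  simp only [MulAut.mul_apply]
  have hs : ∀ z, f (sideVal Γ P m z) = sideVal Γ (p '' P) (p m) (p z) := by
    intro z
    by_cases hz : z ∈ P
    · rw [sideVal_of_mem hz, sideVal_of_mem ((hmem z).2 hz), hp3]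
    · rw [sideVal_of_notMem hz, sideVal_of_notMem (by rwa [hmem]), map_one]
  by_cases hx : x.1 = m.1
  · rw [h.aut_letter_base hx, map_inv, hp3, h'.aut_letter_base ((hfst x m).2 hx)]
  · rw [h.aut_letter hx, hp3, h'.aut_letter (by rwa [Ne, hfst]), map_mul, map_mul, map_inv, hs, hs,
      hp3, hp1]

end Whitehead

/-! ### Whitehead automorphisms of words -/

section Transform

variable {V : Type*} {Γ : SimpleGraph V} {P Q : Set (Sgn V)} {m n : Sgn V}

open Classical in
/-- The side of a letter. -/
noncomputable def side (P : Set (Sgn V)) (x : Sgn V) : Bool := decide (x ∈ P)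

@[simp] theorem side_eq_true {x : Sgn V} : side P x = true ↔ x ∈ P := by simp [side]

@[simp] theorem side_eq_false {x : Sgn V} : side P x = false ↔ x ∉ P := by simp [side]

/-- The letter inserted when changing sides, starting from a given side. -/
def crossLetter (m : Sgn V) (r : Bool) : Sgn V := if r then m.inv else m

@[simp] theorem crossLetter_fst (m : Sgn V) (r : Bool) : (crossLetter m r).1 = m.1 := by
  cases r <;> rfl

open Classical in
/-- The image of a word under a Whitehead automorphism, up to the multiples of the base at the
ends. Letters adjacent to the base are kept, other letters `y` run from the side of `y⁻¹` to the
side of `y`, and a letter of the base is inserted whenever the side has to be changed. -/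
noncomputable def transform (Γ : SimpleGraph V) (P : Set (Sgn V)) (m : Sgn V) :
    List (Sgn V) → Bool → List (Sgn V)
  | [], _ => []
  | y :: w, r =>
    if Γ.Adj y.1 m.1 then y :: transform Γ P m w r
    else (if r = side P y.inv then [] else [crossLetter m r]) ++
      ((if y.1 = m.1 then [] else [y]) ++ transform Γ P m w (side P y))

open Classical in
/-- The side on which a word ends. -/
noncomputable def endSide (Γ : SimpleGraph V) (P : Set (Sgn V)) (m : Sgn V) :
    List (Sgn V) → Bool → Bool
  | [], r => r
  | y :: w, r => if Γ.Adj y.1 m.1 then endSide Γ P m w r else endSide Γ P m w (side P y)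

open Classical in
/-- The number of changes of side along a word. -/
noncomputable def crossings (Γ : SimpleGraph V) (P : Set (Sgn V)) (m : Sgn V) :
    List (Sgn V) → Bool → ℕ
  | [], _ => 0
  | y :: w, r => if Γ.Adj y.1 m.1 then crossings Γ P m w r
    else (if r = side P y.inv then 0 else 1) + crossings Γ P m w (side P y)

theorem transform_append (w u : List (Sgn V)) (r : Bool) :
    transform Γ P m (w ++ u) r =
      transform Γ P m w r ++ transform Γ P m u (endSide Γ P m w r) := by
  induction w generalizing r with
  | nil => rfl
  | cons y w ih =>
    simp only [List.cons_append, endSide, transform]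
    by_cases h : Γ.Adj y.1 m.1 <;> simp [h, ih]

/-- The starting side is forgotten at the first letter not adjacent to the base, so it affects at
most one crossing. -/
theorem crossings_le (w : List (Sgn V)) (r s : Bool) :
    crossings Γ P m w r ≤ crossings Γ P m w s + if r = s then 0 else 1 := by
  induction w generalizing r s with
  | nil => simp [crossings]
  | cons y w ih =>
    simp only [crossings]
    by_cases h : Γ.Adj y.1 m.1
    · simpa [h] using ih r s
    · cases r <;> cases s <;> cases side P y.inv <;> simp [h] <;> omega

/-- The final side is independent of the starting one, unless all letters are adjacent to the base,
when it equals the starting one. Starting from a fixed side makes the rewriting compatible with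
powers. -/
theorem exists_endSide_eq (w : List (Sgn V)) : ∃ s, endSide Γ P m w s = s := by
  have key : (∀ r, endSide Γ P m w r = r) ∨ ∃ s, ∀ r, endSide Γ P m w r = s := by
    induction w with
    | nil => exact .inl fun r => rfl
    | cons y w ih =>
      by_cases h : Γ.Adj y.1 m.1
      · simpa [endSide, h] using ih
      · exact .inr ⟨endSide Γ P m w (side P y), fun r => by simp [endSide, h]⟩
  rcases key with h | ⟨s, h⟩
  · exact ⟨true, h true⟩
  · exact ⟨s, h s⟩

theorem wcount_transform_of_ne {v : V} (hv : v ≠ m.1) (w : List (Sgn V)) (r : Bool) :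
    wcount v (transform Γ P m w r) = wcount v w := by
  induction w generalizing r with
  | nil => rfl
  | cons y w ih =>
    by_cases h : Γ.Adj y.1 m.1
    · simp [transform, h, wcount_cons, ih]
    · by_cases h1 : r = side P y.inv <;> by_cases h2 : y.1 = m.1 <;>
        simp [transform, h, h1, h2, wcount_cons, ih, hv.symm]

theorem wcount_transform (w : List (Sgn V)) (r : Bool) :
    wcount m.1 (transform Γ P m w r) = crossings Γ P m w r := by
  induction w generalizing r with
  | nil => rfl
  | cons y w ih =>
    by_cases h : Γ.Adj y.1 m.1
    · have : y.1 ≠ m.1 := fun e => Γ.irrefl (e ▸ h)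
      simp [transform, crossings, h, wcount_cons, ih, this]
    · by_cases h1 : r = side P y.inv <;> by_cases h2 : y.1 = m.1 <;>
        simp [transform, crossings, h, h1, h2, wcount_cons, ih, Nat.add_comm]

theorem WeakPair.side_base (h : WeakPair Γ P m) {y : Sgn V} (hy : y.1 = m.1) :
    side P y.inv = !side P y := by
  have h1 : side P m = true := side_eq_true.2 h.mem
  have h2 : side P m.inv = false := side_eq_false.2 h.inv_notMem
  rcases Sgn.eq_or_eq_inv hy with rfl | rfl <;> simp [h1, h2]

open Classical in
/-- The value `m` on one side and `1` on the other. -/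
noncomputable def bitVal (Γ : SimpleGraph V) (m : Sgn V) (r : Bool) : RAAG Γ :=
  if r then letter Γ m else 1

theorem sideVal_eq_bitVal (x : Sgn V) : sideVal Γ P m x = bitVal Γ m (side P x) := by
  by_cases hx : x ∈ P
  · rw [sideVal_of_mem hx, side_eq_true.2 hx]; rfl
  · rw [sideVal_of_notMem hx, side_eq_false.2 hx]; rfl

/-- The image of a letter carries a base factor for the side of its inverse on the left and one for
its own side on the right. The factors at the junction of two letters combine into one crossing
letter or cancel. -/
theorem WeakPair.wordVal_transform (h : WeakPair Γ P m) (w : List (Sgn V)) (r : Bool) :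
    wordVal Γ (transform Γ P m w r) =
      (bitVal Γ m r)⁻¹ * h.aut (wordVal Γ w) * bitVal Γ m (endSide Γ P m w r) := by
  induction w generalizing r with
  | nil => simp [transform, endSide]
  | cons y w ih =>
    have hcross : ∀ s, wordVal Γ (if r = s then [] else [crossLetter m r]) =
        (bitVal Γ m r)⁻¹ * bitVal Γ m s := by
      intro s
      cases r <;> cases s <;> simp [bitVal, crossLetter, letter_inv]
    by_cases hy : Γ.Adj y.1 m.1
    · have h1 : y.1 ≠ m.1 := fun e => Γ.irrefl (e ▸ hy)
      obtain ⟨h2, h3⟩ := h.notMem_of_adj hy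
      have h4 : Commute (letter Γ y) (bitVal Γ m r) := by
        unfold bitVal
        split_ifs
        · exact letter_commute hy
        · exact Commute.one_right _
      simp only [transform, hy, if_true, wordVal_cons, ih, endSide, map_mul,
        h.aut_letter_fixed h1 h2 h3, ← mul_assoc, h4.inv_right.eq]
    · simp only [transform, hy, if_false, wordVal_append, hcross, ih, endSide, wordVal_cons,
        map_mul]
      by_cases h1 : y.1 = m.1
      · rw [h.aut_letter_base h1]
        have h5 : bitVal Γ m (side P y.inv) * (bitVal Γ m (side P y))⁻¹ = (letter Γ y)⁻¹ := by
          have h2 : side P m = true := side_eq_true.2 h.mem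
          have h3 : side P m.inv = false := side_eq_false.2 h.inv_notMem
          rcases Sgn.eq_or_eq_inv h1 with rfl | rfl <;> simp [h2, h3, bitVal, letter_inv]
        simp only [h1, if_true, wordVal_nil, one_mul, ← h5]
        group
      · rw [h.aut_letter h1, sideVal_eq_bitVal, sideVal_eq_bitVal]
        simp only [h1, if_false, wordVal_cons, wordVal_nil, mul_one]
        group

/-! ### Transforms of reduced words are reduced -/

theorem transform_cons_adj {y : Sgn V} (h : Γ.Adj y.1 m.1) (w : List (Sgn V)) (r : Bool) :
    transform Γ P m (y :: w) r = y :: transform Γ P m w r := by simp [transform, h]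

theorem WeakPair.transform_cons_base (h : WeakPair Γ P m) {y : Sgn V} (hy : y.1 = m.1)
    (w : List (Sgn V)) (r : Bool) : transform Γ P m (y :: w) r =
      if side P y = r then crossLetter m r :: transform Γ P m w r
      else transform Γ P m w (!r) := by
  have := h.side_base hy
  by_cases h1 : side P y = r
  · subst h1
    simp [transform, hy, this]
  · have h2 : side P y = !r := by revert h1; cases side P y <;> cases r <;> simp
    simp [transform, hy, this, h2]

theorem transform_cons_of_not_adj {y : Sgn V} (hy : y.1 ≠ m.1) (h : ¬ Γ.Adj y.1 m.1)
    (w : List (Sgn V)) (r : Bool) : transform Γ P m (y :: w) r =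
      if side P y.inv = r then y :: transform Γ P m w (side P y)
      else crossLetter m r :: y :: transform Γ P m w (side P y) := by
  by_cases h1 : side P y.inv = r
  · simp [transform, hy, h, h1]
  · simp [transform, hy, h, h1, Ne.symm h1]

theorem not_cancels_cons {x y : Sgn V} {w : List (Sgn V)} (h1 : ¬ Γ.Adj x.1 y.1)
    (h2 : x.1 ≠ y.1) : ¬ Cancels Γ x (y :: w) := by
  rintro (rfl | h)
  · exact h2 rfl
  · exact h1 h.1

theorem WeakPair.cancels_of_adj (h : WeakPair Γ P m) {y : Sgn V} (hy : Γ.Adj y.1 m.1)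
    {w : List (Sgn V)} {r : Bool} (hc : Cancels Γ y (transform Γ P m w r)) : Cancels Γ y w := by
  have hcr : ∀ {r u}, Cancels Γ y (crossLetter m r :: u) → Cancels Γ y u := by
    rintro r u (e | e)
    · have := congrArg Prod.fst e
      simp only [crossLetter_fst, Sgn.inv_fst] at this
      exact (Γ.irrefl (this ▸ hy)).elim
    · exact e.2
  induction w generalizing r with
  | nil => exact hc
  | cons z w ih =>
    by_cases hz : Γ.Adj z.1 m.1
    · rw [transform_cons_adj hz] at hc
      exact hc.imp id fun e => ⟨e.1, ih e.2⟩
    · by_cases hz' : z.1 = m.1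
      · refine .inr ⟨hz' ▸ hy, ?_⟩
        rw [h.transform_cons_base hz'] at hc
        split_ifs at hc
        · exact ih (hcr hc)
        · exact ih hc
      · rw [transform_cons_of_not_adj hz' hz] at hc
        split_ifs at hc
        · exact hc.imp id fun e => ⟨e.1, ih e.2⟩
        · exact (hcr hc).imp id fun e => ⟨e.1, ih e.2⟩

theorem WeakPair.cancels_base_of_crossLetter (h : WeakPair Γ P m) {y : Sgn V} (hy : y.1 = m.1)
    {w : List (Sgn V)} (hc : Cancels Γ (crossLetter m (side P y))
      (transform Γ P m w (side P y))) : Cancels Γ y w := by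
  have hcr : ∀ {r u}, ¬ Cancels Γ (crossLetter m r) (crossLetter m r :: u) := by
    rintro r u (e | e)
    · exact Sgn.ne_inv _ e
    · exact Γ.irrefl e.1
  induction w with
  | nil => exact hc
  | cons z w ih =>
    by_cases hz : Γ.Adj z.1 m.1
    · rw [transform_cons_adj hz] at hc
      refine hc.imp (fun e => ?_) fun e => ⟨hy ▸ hz.symm, ih e.2⟩
      exfalso
      rw [e] at hz
      simp at hz
    · by_cases hz' : z.1 = m.1
      · rw [h.transform_cons_base hz'] at hc
        split_ifs at hc with h1
        · exact (hcr hc).elim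
        · rcases Sgn.eq_or_eq_inv (hz'.trans hy.symm) with rfl | rfl
          · exact (h1 rfl).elim
          · exact .inl rfl
      · rw [transform_cons_of_not_adj hz' hz] at hc
        split_ifs at hc with h1
        · exact (not_cancels_cons (by simpa using fun e => hz e.symm)
            (by simpa using Ne.symm hz') hc).elim
        · exact (hcr hc).elim

theorem WeakPair.side_of_adj (h : WeakPair Γ P m) {x y : Sgn V} (hxy : Γ.Adj x.1 y.1)
    (hx : ¬ Γ.Adj x.1 m.1) (hy : ¬ Γ.Adj y.1 m.1) :
    side P y = side P x ∧ side P y.inv = side P x := by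
  have h1 := h.mem_iff_of_adj hxy hx hy
  have h2 := h.mem_iff_inv hxy.symm hx
  simp only [side, decide_eq_decide]
  exact ⟨h1, h2.trans h1⟩

/-- After the base letter `z` the rewriting is on the side opposite to `y`. A letter cancelling `y`
must be met on the side of `y`, and only `z⁻¹` leads back there without inserting a base letter,
which would block `y`. -/
theorem WeakPair.cancels_base_of_cancels (h : WeakPair Γ P m) {y z : Sgn V} (hy : y.1 ≠ m.1)
    (hym : ¬ Γ.Adj y.1 m.1) (hz : z.1 = m.1) (hyz : side P z = !side P y) {w : List (Sgn V)}
    (hc : Cancels Γ y (transform Γ P m w (side P z))) : Cancels Γ z w := by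
  have hcr : ∀ {r u}, ¬ Cancels Γ y (crossLetter m r :: u) := fun {r u} =>
    not_cancels_cons (by simpa using hym) (by simpa using hy)
  induction w with
  | nil => exact hc
  | cons x w ih =>
    by_cases hx : Γ.Adj x.1 m.1
    · rw [transform_cons_adj hx] at hc
      rcases hc with rfl | hc
      · exact (hym hx).elim
      · exact .inr ⟨hz ▸ hx.symm, ih hc.2⟩
    · by_cases hx' : x.1 = m.1
      · rw [h.transform_cons_base hx'] at hc
        split_ifs at hc with h1
        · exact (hcr hc).elim
        · rcases Sgn.eq_or_eq_inv (hx'.trans hz.symm) with rfl | rfl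
          · exact (h1 rfl).elim
          · exact .inl rfl
      · rw [transform_cons_of_not_adj hx' hx] at hc
        split_ifs at hc with h1
        · rcases hc with rfl | hc
          · rw [Sgn.inv_inv, hyz] at h1
            simp at h1
          · rw [(h.side_of_adj hc.1 hym hx).2, hyz] at h1
            simp at h1
        · exact (hcr hc).elim

/-- Letters passed on the way are adjacent to `y`, so those not adjacent to the base stay on its
side. A base letter that was absorbed in between would have to cancel in `w`, contrary to
reducedness. -/
theorem WeakPair.cancels_of_not_adj (h : WeakPair Γ P m) {y : Sgn V} (hy : y.1 ≠ m.1)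
    (hym : ¬ Γ.Adj y.1 m.1) {w : List (Sgn V)} (hw : Reduced Γ w)
    (hc : Cancels Γ y (transform Γ P m w (side P y))) : Cancels Γ y w := by
  have hcr : ∀ {r u}, ¬ Cancels Γ y (crossLetter m r :: u) := fun {r u} =>
    not_cancels_cons (by simpa using hym) (by simpa using hy)
  induction w with
  | nil => exact hc
  | cons x w ih =>
    by_cases hx : Γ.Adj x.1 m.1
    · rw [transform_cons_adj hx] at hc
      exact hc.imp id fun e => ⟨e.1, ih hw.2 e.2⟩
    · by_cases hx' : x.1 = m.1
      · rw [h.transform_cons_base hx'] at hc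
        split_ifs at hc with h1
        · exact (hcr hc).elim
        · have h2 : side P x = !side P y := by
            revert h1
            cases side P x <;> cases side P y <;> simp
          rw [← h2] at hc
          exact (hw.1 (h.cancels_base_of_cancels hy hym hx' h2 hc)).elim
      · rw [transform_cons_of_not_adj hx' hx] at hc
        split_ifs at hc with h1
        · refine hc.imp id fun e => ⟨e.1, ih hw.2 ?_⟩
          rw [← (h.side_of_adj e.1 hym hx).1]
          exact e.2
        · exact (hcr hc).elim

/-- Each cancellation in the image is traced back to one in `w`, according to whether its first
letter is adjacent to the base, stems from a base letter, or is neither. A crossing letter inserted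
in the last case is blocked by the letter that follows it. -/
theorem WeakPair.reduced_transform (h : WeakPair Γ P m) {w : List (Sgn V)} (hw : Reduced Γ w)
    (r : Bool) : Reduced Γ (transform Γ P m w r) := by
  induction w generalizing r with
  | nil => trivial
  | cons y w ih =>
    have ih := ih hw.2
    by_cases hy : Γ.Adj y.1 m.1
    · rw [transform_cons_adj hy]
      exact ⟨fun hc => hw.1 (h.cancels_of_adj hy hc), ih r⟩
    · by_cases hy' : y.1 = m.1
      · rw [h.transform_cons_base hy']
        split_ifs with h1
        · subst h1
          exact ⟨fun hc => hw.1 (h.cancels_base_of_crossLetter hy' hc), ih _⟩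
        · exact ih _
      · have key : Reduced Γ (y :: transform Γ P m w (side P y)) :=
          ⟨fun hc => hw.1 (h.cancels_of_not_adj hy' hy hw.2 hc), ih _⟩
        rw [transform_cons_of_not_adj hy' hy]
        split_ifs with h1
        · exact key
        · exact ⟨not_cancels_cons (by simpa using fun e => hy e.symm)
            (by simpa using Ne.symm hy'), key⟩

/-! ### Counting letters in images of conjugacy classes -/

theorem transform_wordPow {w : List (Sgn V)} {s : Bool} (hs : endSide Γ P m w s = s) (k : ℕ) :
    transform Γ P m (wordPow k w) s = wordPow k (transform Γ P m w s) := by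
  induction k with
  | zero => rfl
  | succ k ih => rw [wordPow_succ, transform_append, hs, ih, wordPow_succ]

theorem autOnClasses_mk {A : Type*} [Group A] (f : MulAut A) (a : A) :
    autOnClasses A f (ConjClasses.mk a) = ConjClasses.mk (f a) := rfl

/-- A cyclically reduced word has a cyclically reduced transform, which represents the image of
its conjugacy class. -/
theorem WeakPair.exists_transform (h : WeakPair Γ P m) {w : List (Sgn V)}
    (hw : CycReduced Γ w) : ∃ s, endSide Γ P m w s = s ∧ CycReduced Γ (transform Γ P m w s) ∧
      ConjClasses.mk (wordVal Γ (transform Γ P m w s)) =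
        autOnClasses _ h.aut (ConjClasses.mk (wordVal Γ w)) := by
  obtain ⟨s, hs⟩ := exists_endSide_eq (Γ := Γ) (P := P) (m := m) w
  refine ⟨s, hs, fun k => ?_, ?_⟩
  · rw [← transform_wordPow hs]
    exact h.reduced_transform (hw k) s
  · rw [h.wordVal_transform, hs, autOnClasses_mk, ConjClasses.mk_eq_mk_iff_isConj, isConj_iff]
    exact ⟨bitVal Γ m s, by group⟩

/-- From the fixed side the crossings of the power are exactly `k` times the count of the base in
the image class; another starting side costs an error of at most one. -/
theorem WeakPair.crossings_wordPow (h : WeakPair Γ P m) {w : List (Sgn V)}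
    (hw : CycReduced Γ w) (k : ℕ) (r : Bool) :
    crossings Γ P m (wordPow k w) r ≤
        k * classCount Γ m.1 (autOnClasses _ h.aut (ConjClasses.mk (wordVal Γ w))) + 1 ∧
      k * classCount Γ m.1 (autOnClasses _ h.aut (ConjClasses.mk (wordVal Γ w))) ≤
        crossings Γ P m (wordPow k w) r + 1 := by
  obtain ⟨s, hs, h1, h2⟩ := h.exists_transform hw
  have h3 : k * classCount Γ m.1 (autOnClasses _ h.aut (ConjClasses.mk (wordVal Γ w))) =
      crossings Γ P m (wordPow k w) s := by
    rw [← h2, h1.classCount_eq, ← wcount_transform, transform_wordPow hs, wcount_wordPow]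
  have h4 := crossings_le (Γ := Γ) (P := P) (m := m) (wordPow k w) r s
  have h5 := crossings_le (Γ := Γ) (P := P) (m := m) (wordPow k w) s r
  rw [h3]
  split_ifs at h4 h5 <;> omega

/-- This is the submodularity of cuts, letter by letter. The difficulty is a letter adjacent to just
one of the bases, which only one of the two original walks registers. -/
theorem WeakPair.crossings_inter_add_le (h : WeakPair Γ P m) (h' : WeakPair Γ Q n)
    (hmn : ¬ Γ.Adj m.1 n.1) (hm : m ∈ Q) (hn : n.inv ∉ P) (w : List (Sgn V)) (a b : Bool) :
    crossings Γ (P ∩ Q) m w (a && b) +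
        crossings Γ (coside Γ P m ∩ coside Γ Q n) n.inv w (!a && !b) ≤
      crossings Γ P m w a + crossings Γ Q n w b := by
  induction w generalizing a b with
  | nil => simp [crossings]
  | cons y w ih =>
    simp only [crossings, Sgn.inv_fst]
    have hQ : ∀ y : Sgn V, Γ.Adj y.1 m.1 → ¬ Γ.Adj y.1 n.1 → y ∈ Q := by
      intro y h1 h2
      by_contra h3
      exact (h'.opposite.closed y ⟨h2, h3⟩ m h1 hmn).2.2 hm
    have hP : ∀ y : Sgn V, ¬ Γ.Adj y.1 m.1 → Γ.Adj y.1 n.1 → y ∉ P := by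
      intro y h1 h2 h3
      exact hn (h.closed y h3 n.inv h2 fun e => hmn e.symm).2
    by_cases h1 : Γ.Adj y.1 m.1 <;> by_cases h2 : Γ.Adj y.1 n.1
    · simpa [h1, h2] using ih a b
    · have e1 : side Q y = true := side_eq_true.2 (hQ y h1 h2)
      have e2 : side Q y.inv = true := side_eq_true.2 (hQ y.inv h1 h2)
      have e3 : side (coside Γ P m ∩ coside Γ Q n) y = false :=
        side_eq_false.2 fun e => e.1.1 h1
      have e4 : side (coside Γ P m ∩ coside Γ Q n) y.inv = false :=
        side_eq_false.2 fun e => e.1.1 h1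
      have h3 := ih a true
      -- Here `y` and `y⁻¹` lie in `Q` and only the walk for `Q` moves, to the side `true`. The walk
      -- for the intersection keeps its side `a && b`, whereas induction speaks of `a`; if they
      -- differ, the crossing of `Q` pays for it.
      have h4 := crossings_le (Γ := Γ) (P := P ∩ Q) (m := m) w (a && b) a
      simp only [h1, h2, e1, e2, e3, e4, if_true, if_false]
      cases a <;> cases b <;> simp at h3 h4 ⊢ <;> omega
    · have e1 : side P y = false := side_eq_false.2 (hP y h1 h2)
      have e2 : side P y.inv = false := side_eq_false.2 (hP y.inv h1 h2)
      have e3 : side (P ∩ Q) y = false := side_eq_false.2 fun e => hP y h1 h2 e.1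
      have e4 : side (P ∩ Q) y.inv = false := side_eq_false.2 fun e => hP y.inv h1 h2 e.1
      have h3 := ih false b
      have h4 := crossings_le (Γ := Γ) (P := coside Γ P m ∩ coside Γ Q n) (m := n.inv) w
        (!a && !b) (!b)
      simp only [h1, h2, e1, e2, e3, e4, if_true, if_false]
      cases a <;> cases b <;> simp at h3 h4 ⊢ <;> omega
    · have e1 : ∀ z : Sgn V, side (P ∩ Q) z = (side P z && side Q z) := fun z => by
        rw [Bool.eq_iff_iff]
        simp
      have e2 : ∀ z : Sgn V, z.1 = y.1 →
          side (coside Γ P m ∩ coside Γ Q n) z = (!side P z && !side Q z) := fun z hz => by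
        rw [Bool.eq_iff_iff]
        simp [coside, hz, h1, h2]
      have h3 := ih (side P y) (side Q y)
      simp only [h1, h2, e1, e2 y rfl, e2 y.inv rfl, if_false]
      -- The submodular inequality for one step of the walks.
      have h4 : ∀ a b c d : Bool, (if (a && b) = (c && d) then 0 else 1) +
          (if (!a && !b) = (!c && !d) then 0 else 1) ≤
          (if a = c then 0 else 1) + (if b = d then 0 else 1) := by decide
      have h5 := h4 a b (side P y.inv) (side Q y.inv)
      omega

/-- Submodularity. -/
theorem WeakPair.classCount_inter_add_le (h : WeakPair Γ P m) (h' : WeakPair Γ Q n)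
    (hmn : ¬ Γ.Adj m.1 n.1) (hm : m ∈ Q) (hn : n.inv ∉ P) (c : ConjClasses (RAAG Γ)) :
    classCount Γ m.1 (autOnClasses _ (h.inter h' hmn hm hn).aut c) +
        classCount Γ n.1 (autOnClasses _ (h.inter_coside h' hmn hm hn).aut c) ≤
      classCount Γ m.1 (autOnClasses _ h.aut c) + classCount Γ n.1 (autOnClasses _ h'.aut c) := by
  obtain ⟨w, hw, rfl⟩ := exists_cycReduced c
  -- Each of the four crossing numbers contributes an error of at most one.
  refine le_of_forall_mul_le_add_mul (c := 4) fun k => ?_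
  have h1 := ((h.inter h' hmn hm hn).crossings_wordPow hw k (true && true)).2
  have h2 := ((h.inter_coside h' hmn hm hn).crossings_wordPow hw k (!true && !true)).2
  have h3 := (h.crossings_wordPow hw k true).1
  have h4 := (h'.crossings_wordPow hw k true).1
  have h5 := h.crossings_inter_add_le h' hmn hm hn (wordPow k w) true true
  simp only [Sgn.inv_fst] at h2
  rw [mul_add, mul_add]
  omega

theorem classCount_autOnClasses_le {f : MulAut (RAAG Γ)} {v v' : V}
    (hf : ∀ x : Sgn V, ∃ u, wordVal Γ u = f (letter Γ x) ∧ wcount v u ≤ wcount v' [x])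
    (c : ConjClasses (RAAG Γ)) : classCount Γ v (autOnClasses _ f c) ≤ classCount Γ v' c := by
  obtain ⟨w, hw, rfl⟩ := exists_wcount_eq_classCount v' c
  rw [← hw, autOnClasses_mk]
  clear hw
  obtain ⟨u, hu, hv⟩ : ∃ u, wordVal Γ u = f (wordVal Γ w) ∧ wcount v u ≤ wcount v' w := by
    induction w with
    | nil => exact ⟨[], by simp⟩
    | cons x w ih =>
      obtain ⟨u, hu, hv⟩ := ih
      obtain ⟨t, ht, htv⟩ := hf x
      refine ⟨t ++ u, by simp [hu, ht], ?_⟩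
      rw [wcount_append, wcount_cons]
      rw [wcount_cons, wcount_nil] at htv
      omega
  rw [← hu]
  exact (classCount_le v u).trans hv

theorem WeakPair.classCount_of_ne (h : WeakPair Γ P m) {v : V} (hv : v ≠ m.1)
    (c : ConjClasses (RAAG Γ)) : classCount Γ v (autOnClasses _ h.aut c) = classCount Γ v c := by
  obtain ⟨w, hw, rfl⟩ := exists_cycReduced c
  obtain ⟨s, -, h1, h2⟩ := h.exists_transform hw
  rw [← h2, h1.classCount_eq, hw.classCount_eq, wcount_transform_of_ne hv]

/-- Conjugating one automorphism by the other gives a permutation of letters exchanging the two base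
vertices. The outermost factor has base `m`, so it does not affect the count of `n`. -/
theorem WeakPair.classCount_swap (h : WeakPair Γ Q m) (h' : WeakPair Γ Q n) (hne : m.1 ≠ n.1)
    (c : ConjClasses (RAAG Γ)) :
    classCount Γ n.1 (autOnClasses _ h'.aut c) = classCount Γ m.1 (autOnClasses _ h.aut c) := by
  have key : ∀ {m n : Sgn V} (h : WeakPair Γ Q m) (h' : WeakPair Γ Q n), m.1 ≠ n.1 →
      ∀ c, classCount Γ n.1 (autOnClasses _ h'.aut c) ≤
        classCount Γ m.1 (autOnClasses _ h.aut c) := by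
    intro m n h h' hne c
    obtain ⟨p, -, -, hp, hp'⟩ := h.exists_swap h' hne
    have h1 : h'.aut = h.aut * (h.aut * h'.aut * h.aut) * h.aut := by
      have := h.aut_mul_aut
      simp only [← mul_assoc, this, one_mul]
      rw [mul_assoc, this, mul_one]
    rw [h1, map_mul, map_mul, Equiv.Perm.mul_apply, Equiv.Perm.mul_apply,
      h.classCount_of_ne hne.symm]
    refine classCount_autOnClasses_le (fun x => ⟨[p x], ?_, ?_⟩) _
    · rw [hp x]
      simp
    · by_cases hx : x.1 = m.1
      · simp [wcount_cons, hx, (hp' x).2 hx]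
      · simp [wcount_cons, hx, mt (hp' x).1 hx]
  exact le_antisymm (key h h' hne c) (key h' h hne.symm c)

end Transform

/-! ### Whitehead automorphisms are long-range -/

section Membership

variable {V : Type*} {Γ : SimpleGraph V} {P Q : Set (Sgn V)} {m n : Sgn V}

theorem outMk_singleton_mem (m : Sgn V) :
    outMk (WeakPair.singleton Γ m).aut ∈ Outl Γ := by
  refine Subgroup.subset_closure ⟨_, .inr (.inl ⟨m.1, ?_, fun u hu => ?_⟩), rfl⟩
  · have := (WeakPair.singleton Γ m).aut_letter_base (x := (m.1, true)) rfl
    simpa [letter] using this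
  · have h1 : ∀ s, (u, s) ∉ ({m} : Set (Sgn V)) := fun s e => hu (by
      rw [← Set.mem_singleton_iff.1 e])
    have := (WeakPair.singleton Γ m).aut_letter_fixed (x := (u, true)) hu (h1 _) (h1 _)
    simpa [letter] using this

theorem gen_eq_letter (v : V) : gen Γ v = letter Γ (v, true) := by simp [letter]

/-- The generators cover positive letters only. A negative `m` is handled by passing to the inverse
of `g`, a negative `x` by conjugating with an inversion. -/
theorem outMk_mem_of_transvection {g : MulAut (RAAG Γ)} {x : Sgn V} (hne : x.1 ≠ m.1)
    (hadj : ¬ Γ.Adj x.1 m.1) (hle : vle Γ x.1 m.1)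
    (hx : g (letter Γ x) = letter Γ x * letter Γ m)
    (hy : ∀ y : Sgn V, y.1 ≠ x.1 → g (letter Γ y) = letter Γ y) : outMk g ∈ Outl Γ := by
  have key : ∀ {f : MulAut (RAAG Γ)} {v w : V}, v ≠ w → ¬ Γ.Adj v w → vle Γ v w →
      f (gen Γ v) = gen Γ v * gen Γ w → (∀ u, u ≠ v → f (gen Γ u) = gen Γ u) →
      outMk f ∈ Outl Γ := fun {f v w} h1 h2 h3 h4 h5 =>
    Subgroup.subset_closure ⟨f, .inr (.inr (.inr ⟨v, w, h1, h2, h3, h4, h5⟩)), rfl⟩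
  have key2 : ∀ {f : MulAut (RAAG Γ)} {v : V}, v ≠ m.1 → ¬ Γ.Adj v m.1 → vle Γ v m.1 →
      f (gen Γ v) = gen Γ v * letter Γ m → (∀ u, u ≠ v → f (gen Γ u) = gen Γ u) →
      outMk f ∈ Outl Γ := by
    intro f v h1 h2 h3 h4 h5
    obtain ⟨w, _ | _⟩ := m
    · have h6 : f⁻¹ (gen Γ w) = gen Γ w := by
        rw [MulAut.inv_apply, MulEquiv.symm_apply_eq, h5 w h1.symm]
      rw [← inv_mem_iff, ← map_inv]
      refine key h1 h2 h3 ?_ fun u hu => ?_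
      · rw [MulAut.inv_apply, MulEquiv.symm_apply_eq, map_mul, h4, h5 w h1.symm]
        simp [letter]
      · rw [MulAut.inv_apply, MulEquiv.symm_apply_eq, h5 u hu]
    · exact key h1 h2 h3 (by simpa [letter] using h4) h5
  have hy' : ∀ u, u ≠ x.1 → g (gen Γ u) = gen Γ u := fun u hu => by
    simpa [gen_eq_letter] using hy (u, true) hu
  obtain ⟨v, _ | _⟩ := x
  · have hi := WeakPair.singleton Γ ((v, true) : Sgn V)
    have hi1 : hi.aut (gen Γ v) = (gen Γ v)⁻¹ := by
      rw [gen_eq_letter]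
      exact hi.aut_letter_base rfl
    have hi2 : ∀ y : Sgn V, y.1 ≠ v → hi.aut (letter Γ y) = letter Γ y := fun y h => by
      refine hi.aut_letter_fixed h (fun e => h ?_) fun e => h ?_
      · rw [Set.mem_singleton_iff.1 e]
      · rw [← Sgn.inv_fst, Set.mem_singleton_iff.1 e]
    have hg : g (gen Γ v) = (letter Γ m)⁻¹ * gen Γ v := by
      have : g (gen Γ v)⁻¹ = (gen Γ v)⁻¹ * letter Γ m := by simpa [letter] using hx
      rw [map_inv, inv_eq_iff_eq_inv] at this
      rw [this]
      simp
    have h1 : outMk (hi.aut * g * hi.aut) ∈ Outl Γ := by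
      refine key2 hne hadj hle ?_ fun u hu => ?_
      · simp only [MulAut.mul_apply]
        rw [hi1, map_inv, hg, map_inv, map_mul, map_inv, hi2 m (Ne.symm hne), hi1]
        simp
      · simp only [MulAut.mul_apply]
        rw [gen_eq_letter, hi2 _ hu, hy _ hu, hi2 _ hu]
    have h2 := outMk_singleton_mem (Γ := Γ) ((v, true) : Sgn V)
    have h3 : g = hi.aut * (hi.aut * g * hi.aut) * hi.aut := by
      have := hi.aut_mul_aut
      simp only [← mul_assoc, this, one_mul]
      rw [mul_assoc, this, mul_one]
    rw [h3, map_mul, map_mul]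
    exact mul_mem (mul_mem h2 h1) h2
  · exact key2 hne hadj hle (by simpa [letter] using hx) hy'

theorem outMk_mem_of_partialConj {g : MulAut (RAAG Γ)}
    (C : (Γ.induce (st Γ m.1)ᶜ).ConnectedComponent)
    (hC : ∀ x : Sgn V, x.1 ∈ Subtype.val '' C.supp →
      g (letter Γ x) = (letter Γ m)⁻¹ * letter Γ x * letter Γ m)
    (hC' : ∀ x : Sgn V, x.1 ∉ Subtype.val '' C.supp → g (letter Γ x) = letter Γ x) :
    outMk g ∈ Outl Γ := by
  have key : ∀ {f : MulAut (RAAG Γ)},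
      (∀ u, u ∈ Subtype.val '' C.supp → f (gen Γ u) = gen Γ m.1 * gen Γ u * (gen Γ m.1)⁻¹) →
      (∀ u, u ∉ Subtype.val '' C.supp → f (gen Γ u) = gen Γ u) → outMk f ∈ Outl Γ :=
    fun {f} h1 h2 => Subgroup.subset_closure
      ⟨f, .inr (.inr (.inl ⟨m.1, C, fun x => ⟨h1 x, h2 x⟩⟩)), rfl⟩
  have hm : ∀ s, g (letter Γ (m.1, s)) = letter Γ (m.1, s) := fun s => by
    refine hC' _ ?_
    rintro ⟨a, -, ha⟩
    exact a.2 (.inl ha)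
  obtain ⟨w, _ | _⟩ := m
  · refine key (fun u hu => ?_) fun u hu => ?_
    · simpa [letter] using hC (u, true) hu
    · simpa [letter] using hC' (u, true) hu
  · rw [← inv_mem_iff, ← map_inv]
    have hw : g (gen Γ w) = gen Γ w := by simpa [letter] using hm true
    refine key (fun u hu => ?_) fun u hu => ?_
    · have hu' : g (gen Γ u) = (gen Γ w)⁻¹ * gen Γ u * gen Γ w := by
        simpa [letter] using hC (u, true) hu
      rw [MulAut.inv_apply, MulEquiv.symm_apply_eq, map_mul, map_mul, map_inv, hu', hw]
      group
    · have hu' : g (gen Γ u) = gen Γ u := by simpa [letter] using hC' (u, true) hu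
      rw [MulAut.inv_apply, MulEquiv.symm_apply_eq, hu']

/-- Induction on the size of `P`. If `x ≠ m` in `P` has its inverse in `P`, the whole component of
`x` is removed and the automorphisms differ by a partial conjugation. Otherwise `x` alone is removed
and they differ by a transvection. -/
theorem WeakPair.outMk_aut_mem [Finite V] (h : WeakPair Γ P m) : outMk h.aut ∈ Outl Γ := by
  have hstep : ∀ {P Q : Set (Sgn V)} (h : WeakPair Γ P m) (h' : WeakPair Γ Q m),
      outMk h.aut ∈ Outl Γ → outMk (h.aut * h'.aut) ∈ Outl Γ → outMk h'.aut ∈ Outl Γ := by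
    intro P Q h h' h1 h2
    have : h'.aut = h.aut * (h.aut * h'.aut) := by rw [← mul_assoc, h.aut_mul_aut, one_mul]
    rw [this, map_mul]
    exact mul_mem h1 h2
  induction hk : P.ncard using Nat.strong_induction_on generalizing P with
  | _ k ih =>
  subst hk
  by_cases hP : P = {m}
  · subst hP
    exact outMk_singleton_mem m
  obtain ⟨x, hx, hxm⟩ : ∃ x ∈ P, x ≠ m := by
    by_contra! hall
    exact hP (Set.eq_singleton_iff_unique_mem.2 ⟨h.mem, hall⟩)
  have hne : x.1 ≠ m.1 := by
    intro e
    rcases Sgn.eq_or_eq_inv e with rfl | rfl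
    · exact hxm rfl
    · exact h.inv_notMem hx
  by_cases hx' : x.inv ∈ P
  · have hxst : x.1 ∈ (st Γ m.1)ᶜ := by
      rintro (e | e)
      · exact hne e
      · exact h.not_adj x hx e.symm
    set C := (Γ.induce (st Γ m.1)ᶜ).connectedComponentMk ⟨x.1, hxst⟩ with hC
    have hCP : ∀ y : Sgn V, y.1 ∈ Subtype.val '' C.supp → y ∈ P := by
      rintro ⟨v, s⟩ ⟨a, ha, rfl⟩
      have h1 : (Γ.induce (st Γ m.1)ᶜ).Reachable ⟨x.1, hxst⟩ a :=
        (SimpleGraph.ConnectedComponent.exact ha).symm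
      obtain ⟨p⟩ := h1
      have key : ∀ (a b : ((st Γ m.1)ᶜ : Set V)), (Γ.induce (st Γ m.1)ᶜ).Walk a b →
          (∀ s, (a.1, s) ∈ P) → ∀ s, (b.1, s) ∈ P := by
        intro a b p
        induction p with
        | nil => exact id
        | @cons a b c hab _ ih =>
          intro ha
          have hb : ¬ Γ.Adj b.1 m.1 := fun e => b.2 (.inr e.symm)
          exact ih fun s => (h.closed (a.1, true) (ha true) (b.1, s) hab hb).2
      refine key _ _ p (fun t => ?_) s
      rcases Sgn.eq_or_eq_inv (x := (x.1, t)) (y := x) rfl with e | e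
      · rw [e]; exact hx
      · rw [e]; exact hx'
    have hCadj : ∀ y z : Sgn V, y.1 ∈ Subtype.val '' C.supp → Γ.Adj y.1 z.1 →
        ¬ Γ.Adj z.1 m.1 → z.1 ∈ Subtype.val '' C.supp := by
      rintro ⟨v, s⟩ z ⟨a, ha, rfl⟩ hyz hz
      have hz' : z.1 ∈ (st Γ m.1)ᶜ := by
        rintro (e | e)
        · have h1 : Γ.Adj z.1 a.1 := hyz.symm
          rw [e] at h1
          exact a.2 (.inr h1)
        · exact hz e.symm
      refine ⟨⟨z.1, hz'⟩, ?_, rfl⟩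
      have : (Γ.induce (st Γ m.1)ᶜ).Adj ⟨z.1, hz'⟩ a := hyz.symm
      exact (SimpleGraph.ConnectedComponent.sound this.reachable).trans ha
    have hmC : ∀ y : Sgn V, y.1 = m.1 → y.1 ∉ Subtype.val '' C.supp := by
      rintro y hy ⟨a, -, ha⟩
      exact a.2 (.inl (ha.trans hy))
    set P' := P \ {y | y.1 ∈ Subtype.val '' C.supp} with hP'
    have h' : WeakPair Γ P' m := by
      refine ⟨⟨h.mem, hmC m rfl⟩, fun e => h.inv_notMem e.1, fun y hy => h.not_adj y hy.1, ?_⟩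
      rintro y ⟨hyP, hyC⟩ z hyz hz
      obtain ⟨h1, h2⟩ := h.closed y hyP z hyz hz
      exact ⟨⟨h1, hyC⟩, h2, fun e => hyC (hCadj z y e hyz.symm (h.not_adj y hyP))⟩
    have hxC : x.1 ∈ Subtype.val '' C.supp := ⟨⟨x.1, hxst⟩, rfl, rfl⟩
    have hlt : P'.ncard < P.ncard :=
      Set.ncard_lt_ncard ⟨Set.sdiff_subset, fun e => (e hx).2 hxC⟩ (Set.toFinite _)
    refine hstep h' h (ih _ hlt h' rfl) (outMk_mem_of_partialConj C (fun y hy => ?_)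
      fun y hy => ?_)
    · have h1 : y.1 ≠ m.1 := fun e => hmC y e hy
      have h2 : y ∈ P \ P' := ⟨hCP y hy, fun e => e.2 hy⟩
      have h3 : y.inv ∈ P \ P' := ⟨hCP y.inv hy, fun e => e.2 hy⟩
      rw [h'.aut_mul_aut_letter h Set.sdiff_subset h1, sideVal_of_mem h2, sideVal_of_mem h3]
    · by_cases h1 : y.1 = m.1
      · exact h'.aut_mul_aut_letter_base h h1
      · have h2 : y ∉ P \ P' := fun e => e.2 ⟨e.1, hy⟩
        have h3 : y.inv ∉ P \ P' := fun e => e.2 ⟨e.1, hy⟩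
        rw [h'.aut_mul_aut_letter h Set.sdiff_subset h1, sideVal_of_notMem h2,
          sideVal_of_notMem h3]
        simp
  · have h' : WeakPair Γ (P \ {x}) m := by
      refine ⟨⟨h.mem, hxm.symm⟩, fun e => h.inv_notMem e.1, fun y hy => h.not_adj y hy.1, ?_⟩
      rintro y ⟨hyP, hyx⟩ z hyz hz
      obtain ⟨h1, h2⟩ := h.closed y hyP z hyz hz
      refine ⟨⟨h1, ?_⟩, h2, ?_⟩
      · intro e
        rw [Set.mem_singleton_iff] at e
        rw [← e, Sgn.inv_inv] at hx'
        exact hx' hyP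
      · intro e
        rw [Set.mem_singleton_iff] at e
        rw [← e] at hx'
        exact hx' (h.closed z h2 y hyz.symm (h.not_adj y hyP)).1
    have hlt : (P \ {x}).ncard < P.ncard :=
      Set.ncard_lt_ncard ⟨Set.sdiff_subset, fun e => (e hx).2 rfl⟩ (Set.toFinite _)
    have hle : vle Γ x.1 m.1 := by
      intro v hv
      by_contra hv'
      exact hx' (h.closed x hx (v, true) hv fun e => hv' (.inr e.symm)).1
    have hd : P \ (P \ {x}) = {x} := by
      simpa using hx
    have h2 : x.inv ∉ P \ (P \ {x}) := fun e => hx' e.1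
    refine hstep h' h (ih _ hlt h' rfl) (outMk_mem_of_transvection hne (h.not_adj x hx) hle ?_
      fun y hy => ?_)
    · rw [h'.aut_mul_aut_letter h Set.sdiff_subset hne, sideVal_of_notMem h2, hd,
        sideVal_of_mem (Set.mem_singleton x)]
      simp
    · by_cases h1 : y.1 = m.1
      · exact h'.aut_mul_aut_letter_base h h1
      · have h3 : y ∉ ({x} : Set (Sgn V)) := fun e => hy (by rw [Set.mem_singleton_iff.1 e])
        have h4 : y.inv ∉ ({x} : Set (Sgn V)) := fun e => hy (by
          rw [← Sgn.inv_fst, Set.mem_singleton_iff.1 e])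
        rw [h'.aut_mul_aut_letter h Set.sdiff_subset h1, hd, sideVal_of_notMem h3,
          sideVal_of_notMem h4]
        simp

/-- The class of a Whitehead automorphism as an element of `Out_ℓ(A_Γ)`. -/
noncomputable def WeakPair.out [Finite V] (h : WeakPair Γ P m) : Outl Γ :=
  ⟨outMk h.aut, h.outMk_aut_mem⟩

end Membership

/-! ### Peaks -/

section Peak

variable {V : Type*} [Finite V] {Γ : SimpleGraph V} {P Q : Set (Sgn V)} {m n : Sgn V}

/-- The total number of letters of a vertex in the conjugacy classes `φ⁻¹(g)`, `g ∈ 𝒢₀`. -/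
noncomputable def vertexCount (φ : Outl Γ) (v : V) : ℕ :=
  ∑ g ∈ (shortClasses_finite Γ).toFinset,
    classCount Γ v (outOnClasses _ (φ : Out (RAAG Γ))⁻¹ g)

/-- The first coordinate of the norm as a natural number. -/
noncomputable def height (σ : MarkedSalvetti Γ) : ℕ :=
  ∑ g ∈ (shortClasses_finite Γ).toFinset, len σ g

theorem norm0_eq_height (σ : MarkedSalvetti Γ) : norm0 σ = height σ := by
  simp [norm0, height]

omit [Finite V] in
theorem len_marked (φ : Outl Γ) (g : ConjClasses (RAAG Γ)) :
    len (marked φ) g = classLength Γ (outOnClasses _ (φ : Out (RAAG Γ))⁻¹ g) := rfl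

theorem height_marked [Fintype V] (φ : Outl Γ) :
    height (marked φ) = ∑ v, vertexCount φ v := by
  simp only [height, vertexCount, len_marked, classLength_eq_sum]
  exact Finset.sum_comm

theorem WeakPair.coe_out (h : WeakPair Γ P m) : (h.out : Out (RAAG Γ)) = outMk h.aut := rfl

theorem WeakPair.out_mul_out (h : WeakPair Γ P m) : h.out * h.out = 1 :=
  Subtype.ext (by
    rw [Subgroup.coe_mul, h.coe_out, ← map_mul, h.aut_mul_aut, map_one, Subgroup.coe_one])

theorem WeakPair.opposite_out (h : WeakPair Γ P m) : h.opposite.out = h.out :=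
  Subtype.ext h.outMk_opposite

theorem WeakPair.outOnClasses_mul_out (h : WeakPair Γ P m) (φ : Outl Γ)
    (g : ConjClasses (RAAG Γ)) :
    outOnClasses _ ((φ * h.out : Outl Γ) : Out (RAAG Γ))⁻¹ g =
      autOnClasses _ h.aut (outOnClasses _ (φ : Out (RAAG Γ))⁻¹ g) := by
  rw [Subgroup.coe_mul, mul_inv_rev, map_mul, h.coe_out, ← map_inv, h.aut_inv]
  rfl

theorem WeakPair.vertexCount_of_ne (h : WeakPair Γ P m) (φ : Outl Γ) {v : V} (hv : v ≠ m.1) :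
    vertexCount (φ * h.out) v = vertexCount φ v := by
  simp only [vertexCount, h.outOnClasses_mul_out, h.classCount_of_ne hv]

theorem WeakPair.vertexCount_swap (h : WeakPair Γ Q m) (h' : WeakPair Γ Q n) (hne : m.1 ≠ n.1)
    (φ : Outl Γ) : vertexCount (φ * h'.out) n.1 = vertexCount (φ * h.out) m.1 := by
  simp only [vertexCount, WeakPair.outOnClasses_mul_out, h.classCount_swap h' hne]

theorem WeakPair.vertexCount_inter_add_le (h : WeakPair Γ P m) (h' : WeakPair Γ Q n)
    (hmn : ¬ Γ.Adj m.1 n.1) (hm : m ∈ Q) (hn : n.inv ∉ P) (φ : Outl Γ) :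
    vertexCount (φ * (h.inter h' hmn hm hn).out) m.1 +
        vertexCount (φ * (h.inter_coside h' hmn hm hn).out) n.1 ≤
      vertexCount (φ * h.out) m.1 + vertexCount (φ * h'.out) n.1 := by
  simp only [vertexCount, WeakPair.outOnClasses_mul_out, ← Finset.sum_add_distrib]
  exact Finset.sum_le_sum fun g _ => h.classCount_inter_add_le h' hmn hm hn _

/-- The height is the sum of the vertex counts, and only that of the base changes. The equation is
written without subtraction. -/
theorem WeakPair.height_mul_out (h : WeakPair Γ P m) (φ : Outl Γ) :
    height (marked (φ * h.out)) + vertexCount φ m.1 =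
      height (marked φ) + vertexCount (φ * h.out) m.1 := by
  classical
  have := Fintype.ofFinite V
  rw [height_marked, height_marked, ← Finset.add_sum_erase _ _ (Finset.mem_univ m.1),
    ← Finset.add_sum_erase _ (vertexCount φ) (Finset.mem_univ m.1)]
  have : ∑ v ∈ Finset.univ.erase m.1, vertexCount (φ * h.out) v =
      ∑ v ∈ Finset.univ.erase m.1, vertexCount φ v :=
    Finset.sum_congr rfl fun v hv => h.vertexCount_of_ne φ (Finset.ne_of_mem_erase hv)
  omega

omit [Finite V] in
theorem marked_mul_iso (φ : Outl Γ) {ψ : Outl Γ} {f : MulAut (RAAG Γ)} (hf : IsSalvettiIso Γ f)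
    (hψ : (ψ : Out (RAAG Γ)) = outMk f) : marked (φ * ψ) = marked φ :=
  Quotient.sound ⟨f, hf, by rw [Subgroup.coe_mul, hψ]⟩

/-! ### Moves and low paths -/

/-- Whitehead moves in the weak sense. -/
def WeakMove (σ τ : MarkedSalvetti Γ) : Prop :=
  ∃ (φ : Outl Γ) (P : Set (Sgn V)) (m : Sgn V) (h : WeakPair Γ P m),
    σ = marked φ ∧ τ = marked (φ * h.out)

theorem WeakPair.weakMove (h : WeakPair Γ P m) (φ : Outl Γ) :
    WeakMove (marked φ) (marked (φ * h.out)) := ⟨φ, P, m, h, rfl, rfl⟩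

theorem WeakMove.symm {σ τ : MarkedSalvetti Γ} (hm : WeakMove σ τ) : WeakMove τ σ := by
  obtain ⟨φ, P, m, h, rfl, rfl⟩ := hm
  exact ⟨_, P, m, h, rfl, by rw [mul_assoc, h.out_mul_out, mul_one]⟩

/-- Two representatives differ by a permutation of letters, and conjugation by it carries Whitehead
pairs to Whitehead pairs. So every move can be read off a prescribed representative. -/
theorem WeakMove.exists_eq {φ : Outl Γ} {τ : MarkedSalvetti Γ} (hm : WeakMove (marked φ) τ) :
    ∃ (P : Set (Sgn V)) (m : Sgn V) (h : WeakPair Γ P m), τ = marked (φ * h.out) := by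
  obtain ⟨φ', P, m, h, h1, rfl⟩ := hm
  obtain ⟨f, hf, e⟩ := Quotient.exact h1
  obtain ⟨P', m', h', e'⟩ := hf.symm.exists_conj h
  refine ⟨P', m', h', Quotient.sound ⟨f⁻¹, hf.symm, ?_⟩⟩
  have e1 : (φ' : Out (RAAG Γ)) = φ * outMk f⁻¹ := by rw [← e, mul_assoc, ← map_mul]; simp
  rw [Subgroup.coe_mul, Subgroup.coe_mul, h.coe_out, h'.coe_out, e1, mul_assoc, mul_assoc,
    ← map_mul, ← map_mul, e']

/-- `σ` and `τ` are connected by moves through marked complexes of height less than `N`. -/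
def LowPath (N : ℕ) (σ τ : MarkedSalvetti Γ) : Prop :=
  ∃ l : List (MarkedSalvetti Γ), (∀ ρ ∈ l, height ρ < N) ∧
    List.IsChain WeakMove (σ :: (l ++ [τ]))

variable {N : ℕ} {ρ σ τ : MarkedSalvetti Γ}

theorem WeakMove.lowPath (h : WeakMove σ τ) : LowPath N σ τ := ⟨[], by simp, by simpa⟩

theorem LowPath.trans (h : LowPath N ρ σ) (hσ : height σ < N) (h' : LowPath N σ τ) :
    LowPath N ρ τ := by
  obtain ⟨l, hl, hc⟩ := h
  obtain ⟨l', hl', hc'⟩ := h'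
  refine ⟨l ++ σ :: l', ?_, ?_⟩
  · intro t ht
    rcases List.mem_append.1 ht with ht | ht
    · exact hl t ht
    · rcases List.mem_cons.1 ht with rfl | ht
      · exact hσ
      · exact hl' t ht
  · have : ρ :: ((l ++ σ :: l') ++ [τ]) = (ρ :: l) ++ σ :: (l' ++ [τ]) := by simp
    rw [this, List.isChain_split]
    exact ⟨by simpa using hc, hc'⟩

theorem LowPath.symm (h : LowPath N σ τ) : LowPath N τ σ := by
  obtain ⟨l, hl, hc⟩ := h
  refine ⟨l.reverse, by simpa using hl, ?_⟩
  have : τ :: (l.reverse ++ [σ]) = (σ :: (l ++ [τ])).reverse := by simp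
  rw [this, List.isChain_reverse]
  exact hc.imp fun _ _ h => h.symm

theorem WeakPair.weakMove_of_subset (h : WeakPair Γ P m) (h' : WeakPair Γ Q m) (hPQ : P ⊆ Q)
    (φ : Outl Γ) : WeakMove (marked (φ * h.out)) (marked (φ * h'.out)) := by
  have e : φ * h'.out = φ * h.out * (h.sdiff h').out * (WeakPair.singleton Γ m).out := by
    have h1 : h.out * h'.out = (h.sdiff h').out * (WeakPair.singleton Γ m).out :=
      Subtype.ext (by
        simp only [Subgroup.coe_mul, WeakPair.coe_out, ← map_mul, h.aut_nested h' hPQ])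
    rw [mul_assoc, ← h1, mul_assoc, ← mul_assoc h.out, h.out_mul_out, one_mul]
  rw [e, marked_mul_iso _ (isSalvettiIso_singleton m) (WeakPair.coe_out _)]
  exact WeakPair.weakMove _ _

/-- By the swap relation, the second automorphism equals the first, followed by an isomorphism of
the Salvetti complex and the first again. -/
theorem WeakPair.weakMove_rebase (h : WeakPair Γ Q m) (h' : WeakPair Γ Q n) (hne : m.1 ≠ n.1)
    (φ : Outl Γ) : WeakMove (marked (φ * h.out)) (marked (φ * h'.out)) := by
  obtain ⟨p, hp1, hp2, hp3, -⟩ := h.exists_swap h' hne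
  have hs : IsSalvettiIso Γ (h.aut * h'.aut * h.aut) := ⟨p, hp1, hp2, hp3⟩
  have e : φ * h'.out = φ * h.out * (h.out * h'.out * h.out) * h.out := by
    have := h.out_mul_out
    simp only [mul_assoc]
    rw [this, ← mul_assoc h.out h.out, this, one_mul, mul_one]
  have e' : marked (φ * h.out) = marked (φ * h.out * (h.out * h'.out * h.out)) :=
    (marked_mul_iso _ hs (by simp only [Subgroup.coe_mul, WeakPair.coe_out, map_mul])).symm
  rw [e, e']
  exact h.weakMove _

theorem WeakPair.height_lt_iff (h : WeakPair Γ P m) (φ : Outl Γ) :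
    height (marked (φ * h.out)) < height (marked φ) ↔
      vertexCount (φ * h.out) m.1 < vertexCount φ m.1 := by
  have := h.height_mul_out φ
  omega

/-! ### Lowering peaks, case by case -/

/-- The relation closes a square. At its fourth corner the count of `m` is that after the first move
and the count of `n` that after the second, so the height changes add up and the corner is low. -/
theorem WeakPair.lowPath_of_mul_eq (h : WeakPair Γ P m) (h' : WeakPair Γ Q n) {R : Set (Sgn V)}
    (hR : WeakPair Γ R n) (φ : Outl Γ) (hne : m.1 ≠ n.1)
    (e : h'.aut * h.aut = h.aut * hR.aut)
    (hlt : vertexCount (φ * h.out) m.1 + vertexCount (φ * h'.out) n.1 <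
      vertexCount φ m.1 + vertexCount φ n.1) :
    LowPath (height (marked φ)) (marked (φ * h.out)) (marked (φ * h'.out)) := by
  have e' : φ * h'.out * h.out = φ * h.out * hR.out := by
    rw [mul_assoc, mul_assoc]
    congr 1
    exact Subtype.ext (by simp only [Subgroup.coe_mul, WeakPair.coe_out, ← map_mul, e])
  have h1 : WeakMove (marked (φ * h.out)) (marked (φ * h'.out * h.out)) := by
    rw [e']
    exact hR.weakMove _
  have h2 : WeakMove (marked (φ * h'.out * h.out)) (marked (φ * h'.out)) := (h.weakMove _).symm
  refine h1.lowPath.trans ?_ h2.lowPath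
  have h3 := h.height_mul_out (φ * h'.out)
  have h4 := h'.height_mul_out φ
  have h5 := h'.vertexCount_of_ne φ hne
  have h6 : vertexCount (φ * h'.out * h.out) m.1 = vertexCount (φ * h.out) m.1 := by
    rw [e', hR.vertexCount_of_ne _ hne]
  omega

theorem WeakPair.lowPath_of_adj (h : WeakPair Γ P m) (h' : WeakPair Γ Q n)
    (hmn : Γ.Adj m.1 n.1) (φ : Outl Γ)
    (hlt : vertexCount (φ * h.out) m.1 + vertexCount (φ * h'.out) n.1 <
      vertexCount φ m.1 + vertexCount φ n.1) :
    LowPath (height (marked φ)) (marked (φ * h.out)) (marked (φ * h'.out)) :=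
  h.lowPath_of_mul_eq h' h' φ (fun e => Γ.irrefl (e ▸ hmn)) (h.aut_commute_of_adj h' hmn).symm hlt

theorem WeakPair.lowPath_of_disjoint (h : WeakPair Γ P m) (h' : WeakPair Γ Q n)
    (hmn : ¬ Γ.Adj m.1 n.1) (hne : m.1 ≠ n.1) (hd : Disjoint P Q) (hn : n.inv ∉ P) (φ : Outl Γ)
    (hlt : vertexCount (φ * h.out) m.1 + vertexCount (φ * h'.out) n.1 <
      vertexCount φ m.1 + vertexCount φ n.1) :
    LowPath (height (marked φ)) (marked (φ * h.out)) (marked (φ * h'.out)) := by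
  by_cases hm : m.inv ∈ Q
  · refine h.lowPath_of_mul_eq h' (h.union_sdiff h' hmn hd hn hm hne) φ hne ?_ hlt
    rw [← h.aut_mul_aut_mul_aut h' hmn hd hn hm hne, ← mul_assoc, ← mul_assoc, h.aut_mul_aut,
      one_mul]
  · exact h.lowPath_of_mul_eq h' h' φ hne (h.aut_commute_of_disjoint h' hne hd hm hn).symm hlt

/-- By submodularity `P ∩ Q` or the intersection of the opposite sides lowers the height. It is
nested in both sets, or in both opposite sides, so its target is one move from each end. -/
theorem WeakPair.lowPath_of_eq (h : WeakPair Γ P m) (h' : WeakPair Γ Q m) (φ : Outl Γ)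
    (hlt : vertexCount (φ * h.out) m.1 + vertexCount (φ * h'.out) m.1 <
      vertexCount φ m.1 + vertexCount φ m.1) :
    LowPath (height (marked φ)) (marked (φ * h.out)) (marked (φ * h'.out)) := by
  have hs := h.vertexCount_inter_add_le h' Γ.irrefl h'.mem h.inv_notMem φ
  set hX := h.inter h' Γ.irrefl h'.mem h.inv_notMem
  set hZ := h.inter_coside h' Γ.irrefl h'.mem h.inv_notMem
  by_cases hlow : vertexCount (φ * hX.out) m.1 < vertexCount φ m.1
  · exact (hX.weakMove_of_subset h Set.inter_subset_left φ).symm.lowPath.trans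
      ((hX.height_lt_iff φ).2 hlow) (hX.weakMove_of_subset h' Set.inter_subset_right φ).lowPath
  · rw [← h.opposite_out, ← h'.opposite_out]
    refine (hZ.weakMove_of_subset h.opposite Set.inter_subset_left φ).symm.lowPath.trans
      ((hZ.height_lt_iff φ).2 ?_)
      (hZ.weakMove_of_subset h'.opposite Set.inter_subset_right φ).lowPath
    change vertexCount (φ * hZ.out) m.1 < vertexCount φ m.1
    omega

theorem WeakPair.lowPath_of_fst_eq (h : WeakPair Γ P m) (h' : WeakPair Γ Q n)
    (hmn : m.1 = n.1) (φ : Outl Γ)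
    (hlt : vertexCount (φ * h.out) m.1 + vertexCount (φ * h'.out) n.1 <
      vertexCount φ m.1 + vertexCount φ n.1) :
    LowPath (height (marked φ)) (marked (φ * h.out)) (marked (φ * h'.out)) := by
  rcases Sgn.eq_or_eq_inv hmn with rfl | rfl
  · exact h.lowPath_of_eq h' φ hlt
  · rw [← h'.opposite_out] at hlt ⊢
    exact h.lowPath_of_eq h'.opposite φ hlt

/-- Submodularity makes one of the two intersections lower the height. It is nested with one of the
given moves and disjoint from a side of the other, so its target is an intermediate point of the low
path. -/
theorem WeakPair.lowPath_of_mem (h : WeakPair Γ P m) (h' : WeakPair Γ Q n)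
    (hmn : ¬ Γ.Adj m.1 n.1) (hne : m.1 ≠ n.1) (hm : m ∈ Q) (hn : n ∉ P) (hn' : n.inv ∉ P)
    (φ : Outl Γ) (hle : vertexCount (φ * h.out) m.1 ≤ vertexCount φ m.1)
    (hle' : vertexCount (φ * h'.out) n.1 ≤ vertexCount φ n.1)
    (hlt : vertexCount (φ * h.out) m.1 + vertexCount (φ * h'.out) n.1 <
      vertexCount φ m.1 + vertexCount φ n.1) :
    LowPath (height (marked φ)) (marked (φ * h.out)) (marked (φ * h'.out)) := by
  have hs := h.vertexCount_inter_add_le h' hmn hm hn' φ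
  set hX := h.inter h' hmn hm hn'
  set hZ := h.inter_coside h' hmn hm hn'
  by_cases hlow : vertexCount (φ * hX.out) m.1 < vertexCount φ m.1
  · refine (hX.weakMove_of_subset h Set.inter_subset_left φ).symm.lowPath.trans
      ((hX.height_lt_iff φ).2 hlow) ?_
    rw [← h'.opposite_out] at hle' ⊢
    refine hX.lowPath_of_disjoint h'.opposite hmn hne ?_ ?_ φ (add_lt_add_of_lt_of_le hlow hle')
    · exact Set.disjoint_left.2 fun x hx hx' => hx'.2 hx.2
    · rw [Sgn.inv_inv]
      exact fun e => hn e.1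
  · have hlow' : vertexCount (φ * hZ.out) n.1 < vertexCount φ n.1 := by omega
    have h1 : WeakMove (marked (φ * hZ.out)) (marked (φ * h'.out)) := by
      rw [← h'.opposite_out]
      exact hZ.weakMove_of_subset h'.opposite Set.inter_subset_right φ
    refine LowPath.trans ?_ ((hZ.height_lt_iff φ).2 hlow') h1.lowPath
    refine h.lowPath_of_disjoint hZ hmn hne ?_ ?_ φ (add_lt_add_of_le_of_lt hle hlow')
    · exact Set.disjoint_left.2 fun x hx hx' => hx'.1.2 hx
    · rwa [Sgn.inv_inv]

theorem WeakPair.lowPath_of_not_separating (h : WeakPair Γ P m) (h' : WeakPair Γ Q n)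
    (hmn : ¬ Γ.Adj m.1 n.1) (hne : m.1 ≠ n.1) (hn : n ∈ P ↔ n.inv ∈ P) (φ : Outl Γ)
    (hle : vertexCount (φ * h.out) m.1 ≤ vertexCount φ m.1)
    (hle' : vertexCount (φ * h'.out) n.1 ≤ vertexCount φ n.1)
    (hlt : vertexCount (φ * h.out) m.1 + vertexCount (φ * h'.out) n.1 <
      vertexCount φ m.1 + vertexCount φ n.1) :
    LowPath (height (marked φ)) (marked (φ * h.out)) (marked (φ * h'.out)) := by
  wlog hnP : n ∉ P generalizing P m
  · have hnm : ¬ Γ.Adj n.1 m.1 := fun e => hmn e.symm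
    have := this h.opposite hmn hne (by simp [coside, hn, hnm])
    rw [h.opposite_out] at this
    exact this hle hlt fun e => e.2 (not_not.1 hnP)
  have hnP' : n.inv ∉ P := fun e => hnP (hn.2 e)
  by_cases hm : m ∈ Q
  · exact h.lowPath_of_mem h' hmn hne hm hnP hnP' φ hle hle' hlt
  · rw [← h'.opposite_out] at hle' hlt ⊢
    exact h.lowPath_of_mem h'.opposite hmn hne ⟨hmn, hm⟩ hnP' (by simpa using hnP) φ hle hle' hlt

/-- Each set separates the base of the other from its inverse, so the bases have equal links and may
be exchanged. Exchanging them interchanges the counts in the inequality, hence one exchanged move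
lowers the height, and the problem becomes one with a common base vertex. -/
theorem WeakPair.lowPath_of_separating (h : WeakPair Γ P m) (h' : WeakPair Γ Q n)
    (hne : m.1 ≠ n.1) (hm : m ∈ Q) (hm' : m.inv ∉ Q) {k : Sgn V} (hk : k.1 = n.1) (hkP : k ∈ P)
    (hkP' : k.inv ∉ P) (φ : Outl Γ) (hle : vertexCount (φ * h.out) m.1 ≤ vertexCount φ m.1)
    (hle' : vertexCount (φ * h'.out) n.1 ≤ vertexCount φ n.1)
    (hlt : vertexCount (φ * h.out) m.1 + vertexCount (φ * h'.out) n.1 <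
      vertexCount φ m.1 + vertexCount φ n.1) :
    LowPath (height (marked φ)) (marked (φ * h.out)) (marked (φ * h'.out)) := by
  have h1 : WeakPair Γ Q m := h'.rebase hm hm' fun y hy => h.adj_of_adj hkP hkP' (hk ▸ hy)
  have h2 : WeakPair Γ P k :=
    h.rebase hkP hkP' fun y hy => hk.symm ▸ h'.adj_of_adj hm hm' hy
  have hne' : m.1 ≠ k.1 := hk.symm ▸ hne
  have e1 := h1.vertexCount_swap h' hne φ
  have e2 := h.vertexCount_swap h2 hne' φ
  by_cases hlow : vertexCount (φ * h1.out) m.1 < vertexCount φ m.1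
  · exact (h.lowPath_of_eq h1 φ (by omega)).trans ((h1.height_lt_iff φ).2 hlow)
      (h1.weakMove_rebase h' hne φ).lowPath
  · have hlow' : vertexCount (φ * h2.out) k.1 < vertexCount φ k.1 := by
      rw [hk] at e2 ⊢
      omega
    refine (h.weakMove_rebase h2 hne' φ).lowPath.trans ((h2.height_lt_iff φ).2 hlow')
      (h2.lowPath_of_fst_eq h' hk φ ?_)
    omega

/-- Peaks can be lowered. -/
theorem WeakPair.lowPath (h : WeakPair Γ P m) (h' : WeakPair Γ Q n) (φ : Outl Γ)
    (hle : height (marked (φ * h.out)) ≤ height (marked φ))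
    (hle' : height (marked (φ * h'.out)) ≤ height (marked φ))
    (hlt : height (marked (φ * h.out)) + height (marked (φ * h'.out)) <
      height (marked φ) + height (marked φ)) :
    LowPath (height (marked φ)) (marked (φ * h.out)) (marked (φ * h'.out)) := by
  have a1 := h.height_mul_out φ
  have a2 := h'.height_mul_out φ
  have b1 : vertexCount (φ * h.out) m.1 ≤ vertexCount φ m.1 := by omega
  have b2 : vertexCount (φ * h'.out) n.1 ≤ vertexCount φ n.1 := by omega
  have b3 : vertexCount (φ * h.out) m.1 + vertexCount (φ * h'.out) n.1 <
    vertexCount φ m.1 + vertexCount φ n.1 := by omega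
  clear hle hle' hlt a1 a2
  by_cases hmn : Γ.Adj m.1 n.1
  · exact h.lowPath_of_adj h' hmn φ b3
  by_cases hne : m.1 = n.1
  · exact h.lowPath_of_fst_eq h' hne φ b3
  by_cases s1 : n ∈ P ↔ n.inv ∈ P
  · exact h.lowPath_of_not_separating h' hmn hne s1 φ b1 b2 b3
  by_cases s2 : m ∈ Q ↔ m.inv ∈ Q
  · exact (h'.lowPath_of_not_separating h (fun e => hmn e.symm) (Ne.symm hne) s2 φ b2 b1
      (by omega)).symm
  have hnm : ¬ Γ.Adj n.1 m.1 := fun e => hmn e.symm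
  -- Passing to the opposite side of `Q` changes neither the outer class nor the hypotheses.
  wlog hm : m ∈ Q generalizing Q n
  · have := this h'.opposite
    rw [h'.opposite_out] at this
    refine this b2 b3 hmn hne ?_ ?_ hnm ⟨hmn, hm⟩
    · rw [Sgn.inv_inv]
      exact fun e => s1 e.symm
    · simp only [coside, Set.mem_ofPred_eq, Sgn.inv_fst, hmn, not_false_eq_true, true_and]
      tauto
  by_cases hn : n ∈ P
  · exact h.lowPath_of_separating h' hne hm (by tauto) rfl hn (by tauto) φ b1 b2 b3
  · exact h.lowPath_of_separating h' hne hm (by tauto) n.inv_fst (by tauto)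
      (by simpa using hn) φ b1 b2 b3

end Peak

/-! ### Paths between marked Salvetti complexes -/

section Generators

variable {V : Type*} {Γ : SimpleGraph V} {P : Set (Sgn V)} {m : Sgn V}

theorem raagAut_ext_gen {f g : MulAut (RAAG Γ)} (h : ∀ v, f (gen Γ v) = g (gen Γ v)) :
    f = g := by
  refine raagAut_ext fun x => ?_
  unfold letter
  split_ifs <;> simp [h]

theorem IsGraphAut.isSalvettiIso {f : MulAut (RAAG Γ)} (hf : IsGraphAut Γ f) :
    IsSalvettiIso Γ f := by
  obtain ⟨p, hp⟩ := hf
  refine ⟨Equiv.prodCongr p.toEquiv (Equiv.refl Bool), fun x => rfl, fun x y => p.map_adj_iff,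
    fun x => ?_⟩
  unfold letter
  simp only [Equiv.prodCongr_apply, Prod.map_fst, Prod.map_snd, Equiv.refl_apply]
  split_ifs <;> simp [hp]

theorem aut_singleton_gen (m : Sgn V) :
    (WeakPair.singleton Γ m).aut (gen Γ m.1) = (gen Γ m.1)⁻¹ := by
  rw [gen_eq_letter]
  exact WeakPair.aut_letter_base _ rfl

theorem aut_singleton_gen_of_ne {u : V} (hu : u ≠ m.1) :
    (WeakPair.singleton Γ m).aut (gen Γ u) = gen Γ u := by
  have h : ∀ s, (u, s) ∉ ({m} : Set (Sgn V)) := fun s e => hu (by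
    rw [← Set.mem_singleton_iff.1 e])
  rw [gen_eq_letter]
  exact WeakPair.aut_letter_fixed _ hu (h _) (h _)

theorem IsInversion.isSalvettiIso {f : MulAut (RAAG Γ)} (hf : IsInversion Γ f) :
    IsSalvettiIso Γ f := by
  obtain ⟨v, h1, h2⟩ := hf
  have : f = (WeakPair.singleton Γ (v, true)).aut := raagAut_ext_gen fun u => by
    by_cases hu : u = v
    · subst hu
      rw [h1, aut_singleton_gen (u, true)]
    · rw [h2 u hu, aut_singleton_gen_of_ne (m := (v, true)) hu]
  rw [this]
  exact isSalvettiIso_singleton _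

theorem IsPartialConj.exists_eq {f : MulAut (RAAG Γ)} (hf : IsPartialConj Γ f) :
    ∃ (P : Set (Sgn V)) (m : Sgn V) (h : WeakPair Γ P m),
      f = h.aut * (WeakPair.singleton Γ m).aut := by
  obtain ⟨v, C, hC⟩ := hf
  have hv : v ∉ Subtype.val '' C.supp := by
    rintro ⟨a, -, ha⟩
    exact a.2 (.inl ha)
  have h : WeakPair Γ (insert (v, true) {x | x.1 ∈ Subtype.val '' C.supp}) (v, true) := by
    refine ⟨.inl rfl, ?_, ?_, ?_⟩
    · rintro (e | e)
      · exact Sgn.inv_ne _ e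
      · exact hv e
    · rintro x (rfl | ⟨a, -, ha⟩)
      · exact Γ.irrefl
      · exact fun e => a.2 (.inr (by rw [ha]; exact e.symm))
    · rintro x (rfl | ⟨a, ha, hx⟩) y hxy hy
      · exact (hy hxy.symm).elim
      · refine ⟨.inr ⟨a, ha, hx⟩, .inr ?_⟩
        have hy' : y.1 ∈ (st Γ v)ᶜ := by
          rintro (e | e)
          · refine a.2 (.inr ?_)
            rw [e, ← hx] at hxy
            exact hxy.symm
          · exact hy e.symm
        refine ⟨⟨y.1, hy'⟩, ?_, rfl⟩
        have : (Γ.induce (st Γ v)ᶜ).Adj ⟨y.1, hy'⟩ a := by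
          rw [← hx] at hxy
          exact hxy.symm
        exact (SimpleGraph.ConnectedComponent.sound this.reachable).trans ha
  refine ⟨_, _, h, raagAut_ext_gen fun u => ?_⟩
  rw [MulAut.mul_apply]
  by_cases hu : u = v
  · subst hu
    rw [aut_singleton_gen (u, true), map_inv, (hC u).2 hv, gen_eq_letter,
      h.aut_letter_base rfl, inv_inv]
  · rw [aut_singleton_gen_of_ne (m := (v, true)) hu]
    by_cases huC : u ∈ Subtype.val '' C.supp
    · have e1 : ∀ s, (u, s) ∈ insert (v, true) {x : Sgn V | x.1 ∈ Subtype.val '' C.supp} :=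
        fun s => .inr huC
      rw [(hC u).1 huC, gen_eq_letter u, h.aut_letter (x := (u, true)) hu, sideVal_of_mem (e1 _),
        sideVal_of_mem (by exact e1 _), ← gen_eq_letter, ← gen_eq_letter]
    · have e1 : ∀ s, (u, s) ∉ insert (v, true) {x : Sgn V | x.1 ∈ Subtype.val '' C.supp} := by
        rintro s (e | e)
        · exact hu (congrArg Prod.fst e)
        · exact huC e
      rw [(hC u).2 huC, gen_eq_letter u, h.aut_letter_fixed (x := (u, true)) hu (e1 _) (e1 _)]

/-- The base is `w⁻¹`, because a Whitehead automorphism multiplies by the inverse of its base; the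
additional factor undoes the inversion of the base. -/
theorem IsNonadjTransvection.exists_eq {f : MulAut (RAAG Γ)} (hf : IsNonadjTransvection Γ f) :
    ∃ (P : Set (Sgn V)) (m : Sgn V) (h : WeakPair Γ P m),
      f = h.aut * (WeakPair.singleton Γ m).aut := by
  obtain ⟨v, w, hvw, hadj, hle, h1, h2⟩ := hf
  have h : WeakPair Γ ({(v, true), (w, false)} : Set (Sgn V)) (w, false) := by
    refine ⟨.inr rfl, ?_, ?_, ?_⟩
    · rintro (e | e)
      · exact hvw (congrArg Prod.fst e).symm
      · exact Sgn.inv_ne _ e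
    · rintro x (rfl | rfl)
      · exact hadj
      · exact Γ.irrefl
    · rintro x (rfl | rfl) y hxy hy
      · rcases hle hxy with e | e
        · exact (hadj (by simpa [e] using hxy)).elim
        · exact (hy e.symm).elim
      · exact (hy hxy.symm).elim
  refine ⟨_, _, h, raagAut_ext_gen fun u => ?_⟩
  rw [MulAut.mul_apply]
  by_cases hu : u = w
  · subst hu
    rw [aut_singleton_gen (u, false), map_inv, h2 u hvw.symm, gen_eq_letter,
      h.aut_letter_base (x := (u, true)) rfl, inv_inv]
  · rw [aut_singleton_gen_of_ne (m := (w, false)) hu, gen_eq_letter u,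
      h.aut_letter (x := (u, true)) hu, ← gen_eq_letter]
    have e1 : Sgn.inv (u, true) ∉ ({(v, true), (w, false)} : Set (Sgn V)) := by
      rintro (e | e)
      · simpa [Sgn.inv] using congrArg Prod.snd e
      · exact hu (congrArg Prod.fst e)
    rw [sideVal_of_notMem e1, one_mul]
    by_cases huv : u = v
    · subst huv
      rw [sideVal_of_mem (Set.mem_insert _ _), h1]
      simp [letter]
    · have e2 : (u, true) ∉ ({(v, true), (w, false)} : Set (Sgn V)) := by
        rintro (e | e)
        · exact huv (congrArg Prod.fst e)
        · exact hu (congrArg Prod.fst e)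
      rw [sideVal_of_notMem e2, inv_one, mul_one, h2 u huv]

end Generators

section Paths

variable {V : Type*} [Finite V] {Γ : SimpleGraph V} {P : Set (Sgn V)} {m : Sgn V}

theorem reflTransGen_weakMove (φ ψ : Outl Γ) :
    Relation.ReflTransGen WeakMove (marked φ) (marked (φ * ψ)) := by
  have key : ∀ x ∈ Outl Γ, ∀ φ ψ : Outl Γ, (ψ : Out (RAAG Γ)) = x →
      Relation.ReflTransGen WeakMove (marked φ) (marked (φ * ψ)) := by
    intro x hx
    induction hx using Subgroup.closure_induction with
    | mem x hx' =>
      obtain ⟨f, hf, rfl⟩ := hx'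
      intro φ ψ hψ
      have hex : (∃ (P : Set (Sgn V)) (m : Sgn V) (h : WeakPair Γ P m),
          f = h.aut * (WeakPair.singleton Γ m).aut) ∨ IsSalvettiIso Γ f := by
        rcases hf with hf | hf | hf | hf
        · exact .inr hf.isSalvettiIso
        · exact .inr hf.isSalvettiIso
        · exact .inl hf.exists_eq
        · exact .inl hf.exists_eq
      rcases hex with ⟨P, m, h, e⟩ | hs
      · have e1 : ψ = h.out * (WeakPair.singleton Γ m).out :=
          Subtype.ext (by simp only [hψ, e, Subgroup.coe_mul, WeakPair.coe_out, map_mul])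
        rw [e1, ← mul_assoc, marked_mul_iso _ (isSalvettiIso_singleton m) (WeakPair.coe_out _)]
        exact .single (h.weakMove φ)
      · rw [marked_mul_iso φ hs hψ]
    | one =>
      intro φ ψ hψ
      rw [show ψ = 1 from Subtype.ext hψ, mul_one]
    | mul x y hx hy ihx ihy =>
      intro φ ψ hψ
      have e : ψ = (⟨x, hx⟩ : Outl Γ) * ⟨y, hy⟩ := Subtype.ext hψ
      rw [e, ← mul_assoc]
      exact (ihx φ ⟨x, hx⟩ rfl).trans (ihy _ ⟨y, hy⟩ rfl)
    | inv x hx ih =>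
      intro φ ψ hψ
      have h1 := ih (φ * ψ) ψ⁻¹ (by simp [hψ])
      rw [mul_inv_cancel_right] at h1
      have : Std.Symm (WeakMove (Γ := Γ)) := ⟨fun _ _ h => h.symm⟩
      exact Std.Symm.symm _ _ h1
  exact key ψ ψ.2 φ ψ rfl

/-! ### The standard complex -/

theorem mem_shortClasses_iff {c : ConjClasses (RAAG Γ)} :
    c ∈ shortClasses Γ ↔ classLength Γ c ≤ 2 := by
  have := Fintype.ofFinite V
  constructor
  · rintro ⟨w, hw, rfl⟩
    exact (classLength_le w).trans hw
  · intro h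
    obtain ⟨w, hw, rfl⟩ := exists_cycReduced c
    exact ⟨w, hw.classLength_eq.symm.trans_le h, rfl⟩

/-- `S` is a sublevel set of `f`. As many elements leave it as are missed by the image; the former
have value above `N` and the latter at most `N`, so any exchange would raise the sum. -/
theorem mem_of_sum_perm_le {α : Type*} {S : Finset α} {f : α → ℕ} {N : ℕ}
    (hS : ∀ x, x ∈ S ↔ f x ≤ N) (π : Equiv.Perm α) (h : ∑ x ∈ S, f (π x) ≤ ∑ x ∈ S, f x) :
    ∀ x ∈ S, π x ∈ S := by
  classical
  set T := S.map π.toEmbedding with hT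
  have h1 : ∑ x ∈ S, f (π x) = ∑ x ∈ T, f x := by simp [hT]
  have h2 : (T \ S).card = (S \ T).card :=
    Finset.card_sdiff_comm (by simp [hT])
  have h3 : (T \ S).card * (N + 1) ≤ ∑ x ∈ T \ S, f x := by
    rw [← smul_eq_mul]
    refine Finset.card_nsmul_le_sum _ _ _ fun x hx => ?_
    have := (not_congr (hS x)).1 (Finset.mem_sdiff.1 hx).2
    omega
  have h4 : ∑ x ∈ S \ T, f x ≤ (S \ T).card * N := by
    rw [← smul_eq_mul]
    exact Finset.sum_le_card_nsmul _ _ _ fun x hx => (hS x).1 (Finset.mem_sdiff.1 hx).1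
  have h5 := Finset.sum_inter_add_sum_sdiff T S f
  have h6 := Finset.sum_inter_add_sum_sdiff S T f
  rw [Finset.inter_comm] at h6
  have h7 : (T \ S).card = 0 := by
    rw [← h2] at h4
    rw [mul_add] at h3
    omega
  intro x hx
  by_contra hx'
  have : π x ∈ T \ S := Finset.mem_sdiff.2 ⟨by simpa [hT] using hx, hx'⟩
  rw [Finset.card_eq_zero.1 h7] at this
  simp at this

omit [Finite V] in
theorem cycReduced_of_forall_inv_notMem {w : List (Sgn V)} (h : ∀ x ∈ w, x.inv ∉ w) :
    CycReduced Γ w := by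
  have hk : ∀ k, ∀ x ∈ wordPow k w, x ∈ w := by
    intro k x hx
    rw [wordPow, List.mem_flatten] at hx
    obtain ⟨l, hl, hx⟩ := hx
    rwa [List.eq_of_mem_replicate hl] at hx
  exact fun k => reduced_of_forall_inv_notMem fun x hx hx' => h x (hk k x hx) (hk k _ hx')

/-- The set 𝒢₀ is the set of classes of length at most 2, so a move from `marked 1` that does not
raise the height must map it into itself. -/
theorem WeakPair.classLength_of_height_le (h : WeakPair Γ P m)
    (hle : height (marked (1 * h.out)) ≤ height (marked (1 : Outl Γ)))
    {w : List (Sgn V)} (hw : w.length ≤ 2) :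
    classLength Γ (autOnClasses _ h.aut (ConjClasses.mk (wordVal Γ w))) ≤ 2 := by
  have hS : ∀ c, c ∈ (shortClasses_finite Γ).toFinset ↔ classLength Γ c ≤ 2 := fun c => by
    rw [Set.Finite.mem_toFinset, mem_shortClasses_iff]
  refine (hS _).1 (mem_of_sum_perm_le hS (autOnClasses _ h.aut) ?_ _ ?_)
  · simpa only [height, len_marked, h.outOnClasses_mul_out, Subgroup.coe_one, inv_one, map_one,
      Equiv.Perm.one_apply] using hle
  · exact (hS _).2 ((classLength_le w).trans hw)

/-- Two-letter words test the pair: if `y` and `x⁻¹` lay on different sides, the cyclic word `xy`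
would acquire a base letter and have length at least 3. The case `x = y` shows that `x` and `x⁻¹`
are on one side. -/
theorem WeakPair.mem_iff_mem (h : WeakPair Γ P m)
    (hle : height (marked (1 * h.out)) ≤ height (marked (1 : Outl Γ)))
    {x y : Sgn V} (hx : x.1 ≠ m.1) (hxm : ¬ Γ.Adj x.1 m.1) (hy : y.1 ≠ m.1)
    (hym : ¬ Γ.Adj y.1 m.1) : x ∈ P ↔ y ∈ P := by
  have := Fintype.ofFinite V
  have key : ∀ {x y : Sgn V}, x.1 ≠ m.1 → ¬ Γ.Adj x.1 m.1 → y.1 ≠ m.1 → ¬ Γ.Adj y.1 m.1 →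
      x ≠ y.inv → side P y = side P x.inv := by
    intro x y hx hxm hy hym hxy
    have hw : CycReduced Γ [x, y] := cycReduced_of_forall_inv_notMem (by
      have h1 : x.inv ≠ y := fun e => hxy (Sgn.inv_eq_iff.1 e)
      simp [Sgn.inv_ne, h1, hxy.symm])
    obtain ⟨s, hs, h1, h2⟩ := h.exists_transform hw
    have h3 := h.classLength_of_height_le hle (w := [x, y]) le_rfl
    rw [← h2, h1.classLength_eq] at h3
    obtain rfl : side P y = s := by simpa [endSide, hxm, hym] using hs
    by_contra hne
    simp [transform, hxm, hym, hx, hy, hne] at h3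
  have h1 : side P x = side P x.inv := key hx hxm hx hxm x.ne_inv
  have h2 : side P x = side P y := by
    by_cases hxy : x = y.inv
    · have := key hy hym hy hym y.ne_inv
      rw [hxy, this]
    · rw [h1, key hx hxm hy hym hxy]
  rw [← side_eq_true, h2, side_eq_true]

theorem WeakPair.marked_mul_out_of_subset (h : WeakPair Γ P m) (hP : P ⊆ {m}) (φ : Outl Γ) :
    marked (φ * h.out) = marked φ := by
  obtain rfl : P = {m} := hP.antisymm (by simpa using h.mem)
  exact marked_mul_iso _ (isSalvettiIso_singleton m) (WeakPair.coe_out _)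

/-- All letters other than `m`, `m⁻¹` and those adjacent to `m` lie on one side. So `P` or its
opposite side consists of its base alone, and the move is an inversion. -/
theorem WeakMove.eq_of_height_le {σ : MarkedSalvetti Γ}
    (hm : WeakMove (marked (1 : Outl Γ)) σ) (hle : height σ ≤ height (marked (1 : Outl Γ))) :
    σ = marked 1 := by
  obtain ⟨P, m, h, rfl⟩ := hm.exists_eq
  by_cases hP : P ⊆ {m}
  · exact h.marked_mul_out_of_subset hP 1
  · obtain ⟨x, hx, hxm⟩ := Set.not_subset.1 hP
    rw [← h.opposite_out]
    refine h.opposite.marked_mul_out_of_subset ?_ 1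
    rintro y ⟨hym, hy⟩
    by_contra hym'
    have hne : ∀ {z : Sgn V}, z ≠ m → z ≠ m.inv → z.1 ≠ m.1 := by
      intro z h1 h2 e
      exact (Sgn.eq_or_eq_inv e).elim h1 h2
    have hx' : x ≠ m.inv := fun e => h.inv_notMem (e ▸ hx)
    have hy' : y ≠ m := fun e => hy (e ▸ h.mem)
    exact hy ((h.mem_iff_mem hle (hne hxm hx') (h.not_adj x hx) (hne hy' hym') hym).1 hx)

/-! ### Paths without peaks -/

theorem exists_first_not_rel {α : Type*} {R : α → α → Prop} {a : α} {l : List α}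
    (h : ¬ List.IsChain R (a :: l)) :
    (∃ b l', l = b :: l' ∧ ¬ R a b) ∨
      ∃ l₁ z x y l₂, a :: l = l₁ ++ z :: x :: y :: l₂ ∧ R z x ∧ ¬ R x y := by
  induction l generalizing a with
  | nil => exact (h (List.isChain_singleton a)).elim
  | cons b l ih =>
    by_cases hab : R a b
    · right
      rcases ih fun h' => h (List.isChain_cons_cons.2 ⟨hab, h'⟩) with
        ⟨c, l', rfl, hc⟩ | ⟨l₁, z, x, y, l₂, e, h1, h2⟩
      · exact ⟨[], a, b, c, l', rfl, hab, hc⟩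
      · exact ⟨a :: l₁, z, x, y, l₂, by rw [e]; rfl, h1, h2⟩
    · exact .inl ⟨b, l, rfl, hab⟩

theorem exists_lower_of_path {σ : MarkedSalvetti Γ} (hσ : σ ≠ marked 1)
    {L : List (MarkedSalvetti Γ)} (hL : List.IsChain WeakMove L)
    (hhead : L.head? = some (marked 1)) (hlast : L.getLast? = some σ) :
    ∃ τ, WeakMove σ τ ∧ height τ < height σ := by
  -- The multiset of heights along the path decreases when one entry is replaced by finitely many
  -- smaller ones.
  have hwf : WellFounded (Relation.CutExpand ((· < ·) : ℕ → ℕ → Prop)) :=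
    WellFounded.cutExpand wellFounded_lt
  induction hs : (↑(L.map height) : Multiset ℕ) using hwf.induction generalizing L with
  | _ s ih =>
  subst hs
  obtain ⟨l, rfl⟩ : ∃ l, L = marked 1 :: l := by
    cases L with
    | nil => simp at hhead
    | cons a l => exact ⟨l, by simpa using hhead⟩
  by_cases hinc : List.IsChain (fun ρ τ => height ρ < height τ) (marked 1 :: l)
  · obtain ⟨l', e⟩ := List.getLast?_eq_some_iff.1 hlast
    rcases List.eq_nil_or_concat l' with rfl | ⟨l'', τ, rfl⟩
    · simp only [List.nil_append, List.cons.injEq] at e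
      exact (hσ e.1.symm).elim
    · rw [e] at hL hinc
      simp only [List.concat_eq_append, List.append_assoc, List.singleton_append] at hL hinc
      exact ⟨τ, (List.isChain_pair.1 (List.isChain_split.1 hL).2).symm,
        by simpa using (List.isChain_split.1 hinc).2⟩
  · rcases exists_first_not_rel hinc with ⟨b, l', rfl, hb⟩ | ⟨l₁, z, x, y, l₂, e, h1, h2⟩
    · obtain ⟨h3, h4⟩ := List.isChain_cons_cons.1 hL
      -- A first step that does not go up stays at `marked 1`, so the repeated initial entry is
      -- dropped.
      obtain rfl := h3.eq_of_height_le (not_lt.1 hb)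
      refine ih _ ?_ h4 rfl (by simpa using hlast) rfl
      refine ⟨0, height (marked (1 : Outl Γ)), by simp, ?_⟩
      simp only [List.map_cons, ← Multiset.cons_coe, add_zero]
      rw [Multiset.add_comm, Multiset.singleton_add]
    · rw [e] at hL hlast hhead ih
      obtain ⟨h3, h4⟩ := List.isChain_split.1 hL
      obtain ⟨h5, h6⟩ := List.isChain_cons_cons.1 h4
      obtain ⟨h7, h8⟩ := List.isChain_cons_cons.1 h6
      -- The first failure of strict increase, if not at the start, is a peak at `x`: `z` is
      -- strictly lower and `y` is not higher. The entry `x` is replaced by entries of smaller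
      -- height.
      obtain ⟨k, hk, hk'⟩ : LowPath (height x) z y := by
        obtain ⟨φ, rfl⟩ := Quotient.exists_rep x
        obtain ⟨P, m, h, rfl⟩ := h5.symm.exists_eq
        obtain ⟨Q, n, h', rfl⟩ := h7.exists_eq
        have h9 := not_lt.1 h2
        exact h.lowPath h' φ h1.le h9 (add_lt_add_of_lt_of_le h1 h9)
      refine ih _ ?_ (L := l₁ ++ z :: (k ++ y :: l₂)) ?_ ?_ ?_ rfl
      · refine ⟨k.map height, height x, by simpa using hk, ?_⟩
        simp only [List.map_append, List.map_cons, ← Multiset.coe_add, ← Multiset.cons_coe,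
          ← Multiset.singleton_add]
        abel
      · refine List.isChain_split.2 ⟨h3, ?_⟩
        have e1 : z :: (k ++ y :: l₂) = (z :: k) ++ y :: l₂ := rfl
        rw [e1]
        exact List.isChain_split.2 ⟨hk', h8⟩
      · cases l₁ <;> simpa using hhead
      · rw [← hlast]
        simp [List.getLast?_append, List.getLast?_cons]

theorem exists_lower {σ : MarkedSalvetti Γ} (hσ : σ ≠ marked 1) :
    ∃ τ, WeakMove σ τ ∧ height τ < height σ := by
  obtain ⟨φ, rfl⟩ := Quotient.exists_rep σ
  have h := reflTransGen_weakMove 1 φ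
  rw [one_mul] at h
  obtain ⟨l, hl, hlast⟩ := List.exists_isChain_cons_of_relationReflTransGen h
  refine exists_lower_of_path hσ hl rfl ?_
  rw [List.getLast?_eq_some_getLast (by simp), hlast]
  rfl

theorem height_one_le (σ : MarkedSalvetti Γ) : height (marked (1 : Outl Γ)) ≤ height σ := by
  induction hk : height σ using Nat.strong_induction_on generalizing σ with
  | _ k ih =>
  subst hk
  by_cases hσ : σ = marked 1
  · rw [hσ]
  · obtain ⟨τ, -, hlt⟩ := exists_lower hσ
    exact (ih _ hlt τ rfl).trans hlt.le

end Paths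

end RaagOuter

theorem mainTheorem11 {V : Type*} [Finite V] (Γ : SimpleGraph V)
    (g : ℕ → ConjClasses (RaagOuter.RAAG Γ)) (hg : Function.Surjective g)
    (φ : RaagOuter.Outl Γ)
    (hφ : ¬ ∀ τ : RaagOuter.MarkedSalvetti Γ,
      RaagOuter.salvettiNorm g (RaagOuter.marked φ) ≤ RaagOuter.salvettiNorm g τ) :
    ∃ (P : Set (RaagOuter.Sgn V)) (m : RaagOuter.Sgn V) (τ : RaagOuter.MarkedSalvetti Γ),
      RaagOuter.IsWhiteheadMove φ P m τ ∧
        RaagOuter.norm0 τ < RaagOuter.norm0 (RaagOuter.marked φ) := by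
  -- Every other complex has strictly larger first coordinate than `marked 1`, so the lexicographic
  -- minimum is attained there.
  have hne : RaagOuter.marked φ ≠ RaagOuter.marked 1 := by
    intro e
    refine hφ fun τ => ?_
    rw [e]
    by_cases hτ : τ = RaagOuter.marked 1
    · rw [hτ]
    · obtain ⟨ρ, -, hρ⟩ := RaagOuter.exists_lower hτ
      refine Prod.Lex.toLex_le_toLex.2 (.inl ?_)
      simp only [RaagOuter.norm0_eq_height, Nat.cast_lt]
      exact (RaagOuter.height_one_le ρ).trans_lt hρ
  obtain ⟨τ, hm, hlt⟩ := RaagOuter.exists_lower hne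
  obtain ⟨P, m, h, rfl⟩ := hm.exists_eq
  refine ⟨P, m, _, ⟨h.isWhiteheadPair ?_, h.aut, h.outMk_aut_mem, h.isWhiteheadAut, rfl⟩, ?_⟩
  -- A set reduced to its base would give the same marked complex, contradicting the strict
  -- decrease.
  · rw [← Set.not_subsingleton_iff]
    intro hs
    rw [h.marked_mul_out_of_subset (fun x hx => hs hx h.mem)] at hlt
    exact lt_irrefl _ hlt
  · rw [RaagOuter.norm0_eq_height, RaagOuter.norm0_eq_height]
    exact_mod_cast hlt
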